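/- Let $\mathfrak g$ be a compact simple real Lie algebra, let $\mathfrak h=\bigoplus_\alpha\mathfrak h_\alpha$ be a reductive Lie algebra, where the $\mathfrak h_\alpha$ are finitely many simple ideals and one (possibly zero) abelian ideal, let $\iota:\mathfrak h\hookrightarrow\mathfrak g$ be an injective homomorphism, and let $k\ge 1$ be an integer. Conventions. On a compact simple Lie algebra, $(\cdot,\cdot)$ denotes the positive definite invariant metric (a negative multiple of the Killing form) normalised so that long roots have squared length $2$, and $v=1+\langle\rho,\theta^\vee\rangle$ is the dual Coxeter number. For a simple ideal $\mathfrak h_\alpha$, $(\cdot,\cdot)_\alpha$ is its normalised metric, $v^\alpha$ its dual Coxeter number, and the Dynkin index $I_\alpha$ is defined by $(\iota x,\iota y)_{\mathfrak g}=I_\alpha (x,y)_\alpha$. For the abelian ideal put $I_\alpha=1$, $v^\alpha=0$, $(x,y)_\alpha=(\iota x,\iota y)_{\mathfrak g}$. For a basis $(e_a)$ of $\mathfrak h_\alpha$ let $g^\alpha_{ab}$ be the inverse of the matrix $(e_a,e_b)_\alpha$; similarly $g^{\mathfrak g}_{ab}$ for a basis of $\mathfrak g$. Let $P_\alpha$ be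 the orthogonal projection of $\mathfrak g$ onto $\iota(\mathfrak h_\alpha)$, and $C_2^\alpha=-\sum_{a,b} g^\alpha_{ab}\,\mathrm{ad}_{\iota e_a}\mathrm{ad}_{\iota e_b}$ the second Casimir element acting on $\mathfrak g$. Let a level-$k$ current algebra of $\mathfrak g$ in its unitary vacuum representation be given: a complex inner product space $V$ (the finite-energy vectors), operators $J^x_n$ on $V$, real-linear in $x\in\mathfrak g$, for $n\in\mathbb Z$ (the Fourier modes of the currents $j^x$ on the compactified light ray), with $$[J^x_m,J^y_n]=i\,J^{[x,y]}_{m+n}+k\,m\,(x,y)_{\mathfrak g}\,\delta_{m+n,0},\qquad (J^x_n)^\dagger=J^x_{-n},$$ and a unit vector $\Omega$, cyclic for the $J^x_n$, with $J^x_n\Omega=0$ for $n\ge 0$. The Sugawara stress-energy tensors are the fields with modes $$\Theta^{\mathfrak g}_n=\frac{1}{2(k+v^{\mathfrak g})}\sum_{m\in\mathbb Z}\sum_{a,b}g^{\mathfrak g}_{ab}:\!J^{a}_mJ^{b}_{n-m}\!:\,,\qquad \Theta^\alpha_n=\frac{1}{2(I_\alpha k+v^\alpha)}\sum_{m\in\mathbb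 Z}\sum_{a,b}g^\alpha_{ab}:\!J^{\iota e_a}_mJ^{\iota e_b}_{n-m}\!:\,,$$ where $:\!J_mJ_l\!:$ is $J_mJ_l$ for $m<0$ and $J_lJ_m$ for $m\ge0$, and $\Theta^{\mathfrak h}:=\sum_\alpha\Theta^\alpha$. Then the weighted Casimir element $$\widetilde C_2^{\iota(\mathfrak h)}:=\sum_\alpha\frac{2I_\alpha k\,P_\alpha+C_2^\alpha}{2(I_\alpha k+v^\alpha)}$$ is a self-adjoint operator on $(\mathfrak g,(\cdot,\cdot)_{\mathfrak g})$ and satisfies $\widetilde C_2^{\iota(\mathfrak h)}\le 1$. Moreover $\widetilde C_2^{\iota(\mathfrak h)}=1$ if and only if $\iota(\mathfrak h)\subset\mathfrak g$ yields a conformal inclusion, i.e. $\Theta^{\mathfrak h}=\Theta^{\mathfrak g}$. -/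

import Mathlib

open scoped TensorProduct

noncomputable section

namespace CurrentAlgebra

/-! ### Root data and the normalised metric of a compact simple Lie algebra -/

section Normalisation

theorem nonempty_root_of_nontrivial (L : Type*) [LieRing L] [LieAlgebra ℂ L]
    [FiniteDimensional ℂ L] [LieAlgebra.IsKilling ℂ L] [Nontrivial L]
    (H : LieSubalgebra ℂ L) [H.IsCartanSubalgebra] : Nonempty H.root := by
  by_contra hne
  have h1 := LieAlgebra.IsKilling.span_weight_isNonZero_eq_top ℂ L H
  have h2 : {α : LieModule.Weight ℂ H L | α.IsNonZero} = ∅ := by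
    ext α
    simp only [Set.mem_ofPred_eq, Set.mem_empty_iff_false, iff_false]
    intro hα
    exact hne ⟨⟨α, by simpa using hα⟩⟩
  rw [h2, Set.image_empty, Submodule.span_empty] at h1
  have h3 : Subsingleton (Module.Dual ℂ H) := by
    rwa [← Submodule.subsingleton_iff ℂ, ← subsingleton_iff_bot_eq_top]
  have h4 : Subsingleton H := Module.subsingleton_dual_iff ℂ |>.mp h3
  have h5 : H = ⊥ := by
    rw [LieSubalgebra.eq_bot_iff]
    intro x hx
    exact congrArg Subtype.val (Subsingleton.elim (⟨x, hx⟩ : H) 0)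
  have h6 := LieSubalgebra.IsCartanSubalgebra.self_normalizing (H := H)
  obtain ⟨x, hx⟩ := exists_ne (0 : L)
  have : x ∈ H.normalizer := by
    rw [LieSubalgebra.mem_normalizer_iff]
    intro y hy
    rw [h5, LieSubalgebra.mem_bot] at hy
    simp [hy]
  rw [h6, h5, LieSubalgebra.mem_bot] at this
  exact hx this

variable (𝔨 : Type*) [LieRing 𝔨] [LieAlgebra ℝ 𝔨] [FiniteDimensional ℝ 𝔨]

/-- The complexification of a real Lie algebra. -/
abbrev Complexification : Type _ := ℂ ⊗[ℝ] 𝔨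

instance isKilling_complexification [LieAlgebra.IsSimple ℝ 𝔨] :
    LieAlgebra.IsKilling ℂ (Complexification 𝔨) := by
  have hK : (killingForm ℝ 𝔨).Nondegenerate := LieAlgebra.IsKilling.killingForm_nondegenerate ℝ 𝔨
  have hC : (killingForm ℂ (Complexification 𝔨)).Nondegenerate := by
    let b := Module.finBasis ℝ 𝔨
    let c := b.baseChange ℂ
    rw [LinearMap.BilinForm.nondegenerate_iff_det_ne_zero b] at hK
    rw [LinearMap.BilinForm.nondegenerate_iff_det_ne_zero c]
    have hm : LinearMap.BilinForm.toMatrix c (killingForm ℂ (Complexification 𝔨)) =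
        (LinearMap.BilinForm.toMatrix b (killingForm ℝ 𝔨)).map (algebraMap ℝ ℂ) := by
      ext i j
      simp only [LinearMap.BilinForm.toMatrix_apply, Matrix.map_apply, killingForm,
        LieModule.traceForm_baseChange, c, Module.Basis.baseChange_apply,
        LinearMap.BilinForm.baseChange_tmul]
      simp
    rw [hm, ← RingHom.mapMatrix_apply, ← RingHom.map_det]
    simpa using hK
  refine ⟨(LieSubmodule.eq_bot_iff _).mpr fun x hx => ?_⟩
  rw [LieIdeal.mem_killingCompl] at hx
  exact hC.2 x fun y => hx y trivial

/-- A Cartan subalgebra of the complexification (all of them are conjugate). -/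
def cartan : LieSubalgebra ℂ (Complexification 𝔨) :=
  LieSubalgebra.engel ℂ
    (LieAlgebra.exists_isCartanSubalgebra_engel ℂ (Complexification 𝔨)).choose

instance isCartanSubalgebra_cartan : (cartan 𝔨).IsCartanSubalgebra :=
  (LieAlgebra.exists_isCartanSubalgebra_engel ℂ (Complexification 𝔨)).choose_spec

variable [LieAlgebra.IsSimple ℝ 𝔨]

instance nonempty_root : Nonempty (cartan 𝔨).root := by
  have : Nontrivial 𝔨 := by
    by_contra h
    rw [not_nontrivial_iff_subsingleton] at h
    exact LieAlgebra.IsSimple.non_abelian (R := ℝ) (L := 𝔨) ⟨fun _ _ => Subsingleton.elim _ _⟩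
  have : Nontrivial (Complexification 𝔨) := inferInstance
  exact nonempty_root_of_nontrivial (Complexification 𝔨) (cartan 𝔨)

/-- The squared length of a root with respect to the (unnormalised) Killing form
`tr (ad x ∘ ad y)` of the complexification; it is a positive real number. -/
def rootSq (β : (cartan 𝔨).root) : ℝ :=
  ((β : LieModule.Weight ℂ (cartan 𝔨) (Complexification 𝔨))
    ((LieAlgebra.IsKilling.cartanEquivDual (cartan 𝔨)).symm
      (β : LieModule.Weight ℂ (cartan 𝔨) (Complexification 𝔨)).toLinear)).re

/-- A root of maximal length. -/
def longRoot : (cartan 𝔨).root := (Finite.exists_max (rootSq 𝔨)).choose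

/-- The dual Coxeter number `1 + ⟨ρ, θ^∨⟩`, where `θ` is the highest root and `ρ` is half the sum
of the positive roots. A long root `θ` is the highest root of a suitable positive system; there
`⟨β, θ^∨⟩ ≥ 0` for all positive `β`, so that the positive roots contribute
`⟨ρ, θ^∨⟩ = (1/2) ∑ max(0, ⟨β, θ^∨⟩)`, the sum running over all roots `β`. -/
def dualCoxeter : ℝ :=
  1 + (1 / 2) * ((∑ β : (cartan 𝔨).root,
    max 0 ((LieAlgebra.IsKilling.rootSystem (cartan 𝔨)).pairingIn ℤ β (longRoot 𝔨)) : ℤ) : ℝ)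

/-- The normalised invariant metric of a compact simple Lie algebra: the multiple of the Killing
form which is positive definite on the compact real form and for whose complex bilinear extension
(up to the sign, which reflects `T = i x` for hermitian generators `T`)
the long roots have squared length `2`. If `θ` has squared length `ℓ` for the Killing form `B`,
it has squared length `ℓ / c` for `c • B`, hence `c = ℓ / 2`. -/
def normForm : LinearMap.BilinForm ℝ 𝔨 :=
  (-(rootSq 𝔨 (longRoot 𝔨) / 2)) • killingForm ℝ 𝔨

end Normalisation

/-! ### Reductive Lie algebras -/

/-- A decomposition of a Lie algebra into the direct sum of finitely many simple ideals,
indexed by `σ`, and an abelian ideal (possibly zero). A finite-dimensional real Lie algebra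
is reductive if and only if it has such a decomposition. -/
structure ReductiveDecomposition (𝔥 : Type*) [LieRing 𝔥] [LieAlgebra ℝ 𝔥] (σ : Type*) where
  simple : σ → LieIdeal ℝ 𝔥
  abelian : LieIdeal ℝ 𝔥
  isSimple : ∀ a, LieAlgebra.IsSimple ℝ (simple a)
  isLieAbelian : IsLieAbelian abelian
  independent : iSupIndep fun α : Option σ => α.elim abelian simple
  iSup_eq_top : ⨆ α : Option σ, α.elim abelian simple = ⊤

/-- Contraction of a bilinear expression `Φ` in two vectors with the inverse of the metric `B`:
the sum of `g_{ab} Φ(T^a, T^b)` over a basis `T^a`, where `g_{ab}` is the inverse of the matrix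
`g^{ab} = B(T^a, T^b)`. It does not depend on the basis if `B` is nondegenerate. -/
def contract {E W : Type*} [AddCommGroup E] [Module ℝ E] [FiniteDimensional ℝ E]
    [AddCommMonoid W] [Module ℝ W] (B : LinearMap.BilinForm ℝ E) (Φ : E → E → W) : W :=
  let T := Module.finBasis ℝ E
  ∑ a, ∑ b, (LinearMap.BilinForm.toMatrix T B)⁻¹ a b • Φ (T a) (T b)

section Embedding

variable {𝔤 𝔥 σ : Type*} [LieRing 𝔤] [LieAlgebra ℝ 𝔤] [FiniteDimensional ℝ 𝔤]
  [LieAlgebra.IsSimple ℝ 𝔤] [LieRing 𝔥] [LieAlgebra ℝ 𝔥] [FiniteDimensional ℝ 𝔥]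
  (ι : 𝔥 →ₗ⁅ℝ⁆ 𝔤) (D : ReductiveDecomposition 𝔥 σ)

/-- The ideals `𝔥_α`: the abelian ideal for `none`, the simple ideals for `some a`. -/
def ReductiveDecomposition.ideal (α : Option σ) : LieIdeal ℝ 𝔥 := α.elim D.abelian D.simple

/-- The restriction of `ι` to `𝔥_α`, as a linear map. -/
def embed (α : Option σ) : D.ideal α →ₗ[ℝ] 𝔤 :=
  (ι : 𝔥 →ₗ[ℝ] 𝔤) ∘ₗ (D.ideal α).toSubmodule.subtype

/-- The metric `g_α`: the normalised metric of a simple ideal, and the restriction of the metric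
of `𝔤` to the abelian ideal. -/
def metric : (α : Option σ) → LinearMap.BilinForm ℝ (D.ideal α)
  | none => (normForm 𝔤).comp (embed ι D none) (embed ι D none)
  | some a => haveI := D.isSimple a; (normForm (D.simple a) : LinearMap.BilinForm ℝ (D.simple a))

/-- The Dynkin index `I_α`: the number with `(ι x, ι y)_𝔤 = I_α (x, y)_α` on a simple ideal, and
`1` for the abelian ideal. -/
def dynkinIndex : Option σ → ℝ
  | none => 1
  | some a => Classical.epsilon fun I : ℝ => ∀ x y : D.ideal (some a),
      normForm 𝔤 (embed ι D (some a) x) (embed ι D (some a) y) = I * metric ι D (some a) x y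

/-- The dual Coxeter number `v^α` of a simple ideal, and `0` for the abelian ideal. -/
def coxeter : Option σ → ℝ
  | none => 0
  | some a => haveI := D.isSimple a; dualCoxeter (D.simple a)

/-- The orthogonal projection `P_α` of `𝔤` onto `ι(𝔥_α)` with respect to the metric of `𝔤`. -/
def proj (α : Option σ) : Module.End ℝ 𝔤 :=
  contract ((normForm 𝔤).comp (embed ι D α) (embed ι D α)) fun a b =>
    (normForm 𝔤 (embed ι D α b)).smulRight (embed ι D α a)

/-- The second Casimir element `C₂^α` of `𝔥_α` acting on `𝔤` through the adjoint representation: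
`g_{ab} Ad(T^a) Ad(T^b)` for the hermitian generators `T = i x` with `x` in the real Lie algebra,
which accounts for the sign. -/
def casimir (α : Option σ) : Module.End ℝ 𝔤 :=
  contract (metric ι D α) fun a b =>
    -(LieAlgebra.ad ℝ 𝔤 (embed ι D α a) * LieAlgebra.ad ℝ 𝔤 (embed ι D α b))

/-- The weighted Casimir element at level `k`. -/
def weightedCasimir [Fintype σ] (k : ℕ) : Module.End ℝ 𝔤 :=
  ∑ α : Option σ, (1 / (2 * (dynkinIndex ι D α * k + coxeter D α))) •
    ((2 * dynkinIndex ι D α * k) • proj ι D α + casimir ι D α)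

end Embedding

/-! ### Current algebras and Sugawara tensors -/

section Currents

variable {𝔤 : Type*} [LieRing 𝔤] [LieAlgebra ℝ 𝔤] [FiniteDimensional ℝ 𝔤]
  [LieAlgebra.IsSimple ℝ 𝔤]

/-- The (unitary, positive energy) vacuum representation of the level-`k` current algebra of `𝔤`
on the space `V` of finite-energy vectors. `J x n` is the `n`-th Fourier mode of the current
`j^x`: in the coordinate `z = (1 + i t) / (1 - i t) = e^{iϑ}` of the compactified light ray one has
`j^x(t) dt = (2π)⁻¹ ∑ₙ (J x n) e^{-inϑ} dϑ`, and the relations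
`[j^x(s), j^y(t)] = i j^{[x,y]}(s) δ(s-t) + k (x,y) (i / 2π) δ'(s-t)`, `j^x(t)^† = j^x(t)`
become those below. -/
structure VacuumCurrents (𝔤 : Type*) [LieRing 𝔤] [LieAlgebra ℝ 𝔤] [FiniteDimensional ℝ 𝔤]
    [LieAlgebra.IsSimple ℝ 𝔤] (k : ℕ) (V : Type*) [NormedAddCommGroup V]
    [InnerProductSpace ℂ V] where
  /-- the modes of the currents -/
  J : 𝔤 →ₗ[ℝ] (ℤ → Module.End ℂ V)
  /-- the vacuum vector -/
  Ω : V
  norm_vacuum : ‖Ω‖ = 1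
  commutator : ∀ (x y : 𝔤) (m n : ℤ),
    J x m * J y n - J y n * J x m = Complex.I • J ⁅x, y⁆ (m + n) +
      (if m + n = 0 then ((k * m * normForm 𝔤 x y : ℝ) : ℂ) else 0) • (1 : Module.End ℂ V)
  hermitian : ∀ (x : 𝔤) (n : ℤ) (φ ψ : V), inner ℂ (J x n φ) ψ = inner ℂ φ (J x (-n) ψ)
  annihilation : ∀ (x : 𝔤) (n : ℤ), 0 ≤ n → J x n Ω = 0
  cyclic : ∀ W : Submodule ℂ V, Ω ∈ W → (∀ x n, ∀ φ ∈ W, J x n φ ∈ W) → W = ⊤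

variable {k : ℕ} {V : Type*} [NormedAddCommGroup V] [InnerProductSpace ℂ V]

/-- The normal ordered product `:(J x m) (J y n):`. -/
def normalOrder (A : VacuumCurrents 𝔤 k V) (x y : 𝔤) (m n : ℤ) : Module.End ℂ V :=
  if m < 0 then A.J x m * A.J y n else A.J y n * A.J x m

/-- The `n`-th mode of the field `(π / N) g_{ab} :j^{τ a} j^{τ b}:`, for colours in the range of
`τ` and the inverse `g_{ab}` of a metric `B`; in modes the prefactor is `1 / (2N)`. On every
finite-energy vector only finitely many terms of the sum over `m` are nonzero. A field is
identified with the family of its modes. -/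
def sugawara {E : Type*} [AddCommGroup E] [Module ℝ E] [FiniteDimensional ℝ E]
    (A : VacuumCurrents 𝔤 k V) (τ : E →ₗ[ℝ] 𝔤) (B : LinearMap.BilinForm ℝ E) (N : ℝ)
    (n : ℤ) (φ : V) : V :=
  (1 / (2 * N)) • ∑ᶠ m : ℤ, (contract B fun a b => normalOrder A (τ a) (τ b) m (n - m)) φ

/-- The Sugawara stress-energy tensor `Θ^𝔤`. -/
def stressG (A : VacuumCurrents 𝔤 k V) : ℤ → V → V :=
  sugawara A LinearMap.id (normForm 𝔤) (k + dualCoxeter 𝔤)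

variable {𝔥 σ : Type*} [LieRing 𝔥] [LieAlgebra ℝ 𝔥] [FiniteDimensional ℝ 𝔥]

/-- The stress-energy tensor `Θ^𝔥 = ∑_α Θ^α`. -/
def stressH [Fintype σ] (A : VacuumCurrents 𝔤 k V) (ι : 𝔥 →ₗ⁅ℝ⁆ 𝔤)
    (D : ReductiveDecomposition 𝔥 σ) : ℤ → V → V :=
  ∑ α : Option σ, sugawara A (embed ι D α) (metric ι D α) (dynkinIndex ι D α * k + coxeter D α)

end Currents

end CurrentAlgebra

end

open CurrentAlgebra

/-!
A quadratic field `∑ₘ g_{ab} :J^a_m J^b_{n-m}:` is determined by the symmetric tensor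
`t = g_{ab} T^a ⊗ T^b`, and its commutator with the currents depends only on `⁅x, t⁆` and on the
operator by which its zero mode acts on the states `J^x_{-1}Ω` of energy one. This weight operator
is the identity for `Θ^𝔤` and the weighted Casimir element for `Θ^𝔥`. Both `Θ^𝔤` and `Θ^𝔥` have
the currents of `𝔥` as primary fields of weight one, so the coset field `Θ^𝔤 - Θ^𝔥` commutes with
these currents, and the squared norm of its mode `-1` on `J^x_{-1}Ω` is `2k (x, (1 - C̃₂) x)`. This
is the inequality. If `C̃₂ = 1`, then the weight operator of the coset field vanishes, so that its
commutators with the currents are again quadratic fields with vanishing weight operator, whose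
tensors are the `⁅x, t⁆`. By induction on the mode number all these fields annihilate the vacuum,
and by cyclicity they vanish.
-/

noncomputable section

namespace CurrentAlgebra

section LongRoots

variable {I R M N : Type*} [CommRing R]
  [AddCommGroup M] [Module R M] [AddCommGroup N] [Module R N]
  (P : RootPairing I R M N) [P.IsCrystallographic]

theorem algebraMap_sum_sq_pairingIn [Fintype I] (i : I) :
    algebraMap ℤ R (∑ j, P.pairingIn ℤ j i ^ 2) = P.CorootForm (P.coroot i) (P.coroot i) := by
  simp only [map_sum, sq, map_mul, P.algebraMap_pairingIn, P.corootForm_apply_apply,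
    P.root_coroot_eq_pairing]

variable [CharZero R]

theorem pairingIn_flip (i j : I) : P.flip.pairingIn ℤ i j = P.pairingIn ℤ j i := by
  apply FaithfulSMul.algebraMap_injective ℤ R
  rw [P.algebraMap_pairingIn, P.flip.algebraMap_pairingIn, P.pairing_flip]

theorem rootLength_posRootForm_flip [Fintype I] (i : I) :
    (P.flip.posRootForm ℤ).rootLength i = ∑ j, P.pairingIn ℤ j i ^ 2 := by
  apply FaithfulSMul.algebraMap_injective ℤ R
  rw [RootPairing.RootPositiveForm.algebraMap_rootLength, algebraMap_sum_sq_pairingIn]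
  rfl

variable {P} [IsDomain R]

theorem pairingIn_mem_of_rootLength_flip_le [Finite I] (B : P.flip.RootPositiveForm ℤ) {i j : I}
    (hB : B.rootLength i ≤ B.rootLength j) (hj : j ≠ i) (hj' : j ≠ P.reflectionPerm i i) :
    P.pairingIn ℤ j i ∈ ({-1, 0, 1} : Set ℤ) := by
  by_contra h
  have hlt : B.rootLength j < B.rootLength i := by
    refine B.rootLength_lt_of_pairingIn_notMem (fun e => ?_) (fun e => ?_) ?_
    · exact hj (P.coroot.injective e).symm
    · exact hj' (P.coroot_eq_neg_iff.mp (neg_eq_iff_eq_neg.mp e.symm))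
    · rwa [pairingIn_flip]
  exact hlt.not_ge hB

/-- The identity behind `∑_β ⟨β, θ^∨⟩² = 4 v`: for a root `i` with shortest coroot the squares
of the pairings other than `±2` are `0` or `1`, and the reflection in `i` interchanges the
positive pairings with the negative ones. -/
theorem sum_sq_pairingIn_eq [Fintype I] (B : P.flip.RootPositiveForm ℤ) {i : I}
    (hB : ∀ j, B.rootLength i ≤ B.rootLength j) :
    ∑ j, P.pairingIn ℤ j i ^ 2 = 4 + 2 * ∑ j, max 0 (P.pairingIn ℤ j i) := by
  classical
  let s := P.reflectionPerm i
  have pairing_s (j : I) : P.pairingIn ℤ (s j) i = -P.pairingIn ℤ j i := by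
    rw [← P.pairingIn_reflectionPerm, P.pairingIn_reflectionPerm_self_right]
  have pairing_self : P.pairingIn ℤ i i = 2 := by simp
  have s_ne : s i ≠ i := fun h => by
    have := pairing_s i
    rw [h, pairing_self] at this
    norm_num at this
  have sq_eq (j : I) : P.pairingIn ℤ j i ^ 2 =
      max 0 (P.pairingIn ℤ j i) + max 0 (P.pairingIn ℤ (s j) i) +
        ((if j = i then 2 else 0) + (if j = s i then 2 else 0)) := by
    rw [pairing_s]
    by_cases h : j = i
    · simp [h, s_ne.symm]
    by_cases h' : j = s i
    · simp [h', pairing_s, s_ne]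
    have := pairingIn_mem_of_rootLength_flip_le B (hB j) h h'
    simp only [Set.mem_insert_iff, Set.mem_singleton_iff] at this
    rcases this with e | e | e <;> simp [e, h, h']
  calc ∑ j, P.pairingIn ℤ j i ^ 2
      = ∑ j, max 0 (P.pairingIn ℤ j i) + ∑ j, max 0 (P.pairingIn ℤ (s j) i) + (2 + 2) := by
        simp only [sq_eq, Finset.sum_add_distrib, Finset.sum_ite_eq', Finset.mem_univ, if_true]
    _ = 4 + 2 * ∑ j, max 0 (P.pairingIn ℤ j i) := by
        rw [s.sum_comp fun j => max 0 (P.pairingIn ℤ j i)]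
        ring

end LongRoots

section KillingNormalisation

open LieAlgebra LieAlgebra.IsKilling LieModule

variable {L : Type*} [LieRing L] [LieAlgebra ℂ L] [FiniteDimensional ℂ L] [IsKilling ℂ L]
  {H : LieSubalgebra ℂ L} [H.IsCartanSubalgebra]

theorem sum_sq_pairingIn_mul_root_sq (α : H.root) :
    ((∑ β, (rootSystem H).pairingIn ℤ β α ^ 2 : ℤ) : ℂ) *
      α.1 ((cartanEquivDual H).symm α.1.toLinear) = 4 := by
  have hα : α.1.IsNonZero := H.isNonZero_coe_root α
  have hne := root_apply_cartanEquivDual_symm_ne_zero hα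
  have hcoroot : traceForm ℂ H L (coroot α) (coroot α) =
      2 * ((α.1 ((cartanEquivDual H).symm α.1.toLinear))⁻¹ * 2) := by
    rw [traceForm_coroot, root_apply_coroot hα, nsmul_eq_mul, smul_eq_mul, Nat.cast_ofNat]
  have hsum := algebraMap_sum_sq_pairingIn (rootSystem H) α
  rw [corootForm_rootSystem_eq_killing, restrict_killingForm, rootSystem_coroot_apply, hcoroot,
    algebraMap_int_eq, eq_intCast] at hsum
  rw [hsum]
  field_simp
  norm_num

variable (𝔨 : Type*) [LieRing 𝔨] [LieAlgebra ℝ 𝔨] [FiniteDimensional ℝ 𝔨]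
  [LieAlgebra.IsSimple ℝ 𝔨]

theorem sum_sq_pairingIn_mul_rootSq (α : (cartan 𝔨).root) :
    ((∑ β, (rootSystem (cartan 𝔨)).pairingIn ℤ β α ^ 2 : ℤ) : ℝ) * rootSq 𝔨 α = 4 := by
  have h := congrArg Complex.re (sum_sq_pairingIn_mul_root_sq α)
  rw [← Complex.ofReal_intCast, Complex.re_ofReal_mul] at h
  exact h

theorem rootSq_pos (α : (cartan 𝔨).root) : 0 < rootSq 𝔨 α := by
  have hsum : (0 : ℝ) ≤ ((∑ β, (rootSystem (cartan 𝔨)).pairingIn ℤ β α ^ 2 : ℤ) : ℝ) :=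
    Int.cast_nonneg (Finset.sum_nonneg fun β _ => sq_nonneg _)
  refine pos_of_mul_pos_right ?_ hsum
  rw [sum_sq_pairingIn_mul_rootSq]
  exact four_pos

theorem sum_sq_pairingIn_longRoot_le (α : (cartan 𝔨).root) :
    ∑ β, (rootSystem (cartan 𝔨)).pairingIn ℤ β (longRoot 𝔨) ^ 2 ≤
      ∑ β, (rootSystem (cartan 𝔨)).pairingIn ℤ β α ^ 2 := by
  have hle : rootSq 𝔨 α ≤ rootSq 𝔨 (longRoot 𝔨) := (Finite.exists_max (rootSq 𝔨)).choose_spec α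
  have hα := sum_sq_pairingIn_mul_rootSq 𝔨 α
  have hθ := sum_sq_pairingIn_mul_rootSq 𝔨 (longRoot 𝔨)
  rw [← Int.cast_le (R := ℝ), eq_div_of_mul_eq (rootSq_pos 𝔨 _).ne' hα,
    eq_div_of_mul_eq (rootSq_pos 𝔨 _).ne' hθ]
  exact div_le_div_of_nonneg_left four_pos.le (rootSq_pos 𝔨 α) hle

theorem dualCoxeter_mul_rootSq : dualCoxeter 𝔨 * rootSq 𝔨 (longRoot 𝔨) = 1 := by
  have hsq := sum_sq_pairingIn_eq ((rootSystem (cartan 𝔨)).flip.posRootForm ℤ) (i := longRoot 𝔨)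
    fun α => by
      simpa only [rootLength_posRootForm_flip] using sum_sq_pairingIn_longRoot_le 𝔨 α
  have h := sum_sq_pairingIn_mul_rootSq 𝔨 (longRoot 𝔨)
  rw [hsq] at h
  rw [dualCoxeter]
  push_cast at h ⊢
  linear_combination h / 4

theorem dualCoxeter_pos : 0 < dualCoxeter 𝔨 :=
  pos_of_mul_pos_left (by rw [dualCoxeter_mul_rootSq]; exact one_pos) (rootSq_pos 𝔨 _).le

theorem killingForm_eq_smul_normForm :
    killingForm ℝ 𝔨 = (-(2 * dualCoxeter 𝔨)) • normForm 𝔨 := by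
  rw [normForm, smul_smul]
  have : -(2 * dualCoxeter 𝔨) * -(rootSq 𝔨 (longRoot 𝔨) / 2) = 1 := by
    linear_combination dualCoxeter_mul_rootSq 𝔨
  rw [this, one_smul]

end KillingNormalisation

section Contraction

theorem isUnit_det_toMatrix {n E : Type*} [Fintype n] [DecidableEq n] [AddCommGroup E]
    [Module ℝ E] {S : LinearMap.BilinForm ℝ E} (T : Module.Basis n ℝ E) (hS : S.Nondegenerate) :
    IsUnit (LinearMap.BilinForm.toMatrix T S).det :=
  ((LinearMap.BilinForm.nondegenerate_iff_det_ne_zero T).mp hS).isUnit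

variable {E W W' : Type*} [AddCommGroup E] [Module ℝ E] [FiniteDimensional ℝ E]
  [AddCommGroup W] [Module ℝ W] [AddCommGroup W'] [Module ℝ W']
  {S : LinearMap.BilinForm ℝ E}

theorem map_contract (f : W →ₗ[ℝ] W') (S : LinearMap.BilinForm ℝ E) (Φ : E → E → W) :
    f (contract S Φ) = contract S fun a b => f (Φ a b) := by
  simp only [contract, map_sum, map_smul]

theorem contract_smul (c : ℝ) (Φ : E → E → W) :
    contract S (fun a b => c • Φ a b) = c • contract S Φ := by
  simp only [contract, smul_comm _ c, Finset.smul_sum]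

theorem contract_smul_smulRight (c : ℝ) (f : E → W →ₗ[ℝ] ℝ) (g : E → W') :
    contract S (fun a b => (c • f b).smulRight (g a)) =
      c • contract S fun a b => (f b).smulRight (g a) := by
  rw [← contract_smul]
  congr! 3
  exact LinearMap.ext fun x => smul_assoc c (f _ x) (g _)

theorem contract_neg (Φ : E → E → W) : contract S (fun a b => -Φ a b) = -contract S Φ := by
  simp only [contract, smul_neg, Finset.sum_neg_distrib]

theorem contract_flip (hS : S.IsSymm) (Φ : E → E → W) :
    contract S (fun a b => Φ b a) = contract S Φ := by
  have htranspose : (LinearMap.BilinForm.toMatrix (Module.finBasis ℝ E) S).IsSymm :=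
    Matrix.ext fun i j => by
      rw [Matrix.transpose_apply, LinearMap.BilinForm.toMatrix_apply,
        LinearMap.BilinForm.toMatrix_apply, hS.eq]
  simp only [contract]
  rw [Finset.sum_comm]
  refine Finset.sum_congr rfl fun a _ => Finset.sum_congr rfl fun b _ => ?_
  rw [htranspose.inv.apply]

theorem contract_smul_form (hS : S.Nondegenerate) {c : ℝ} (hc : c ≠ 0) (Φ : E → E → W) :
    contract (c • S) Φ = c⁻¹ • contract S Φ := by
  have := invertibleOfNonzero hc
  simp only [contract, map_smul, Matrix.inv_smul _ c (isUnit_det_toMatrix _ hS), Finset.smul_sum,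
    Matrix.smul_apply, invOf_eq_inv, smul_assoc]

theorem contract_smulRight (hS : S.Nondegenerate) :
    contract S (fun a b => (S b).smulRight a) = LinearMap.id := by
  let T := Module.finBasis ℝ E
  refine T.ext fun c => ?_
  have hinv := Matrix.nonsing_inv_mul _ (isUnit_det_toMatrix T hS)
  have hsum (a) : ∑ b, (LinearMap.BilinForm.toMatrix T S)⁻¹ a b * S (T b) (T c) =
      (1 : Matrix _ _ ℝ) a c := by
    rw [← hinv, Matrix.mul_apply]
    simp only [LinearMap.BilinForm.toMatrix_apply]
  change LinearMap.applyₗ (T c) (contract S _) = _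
  rw [map_contract]
  simp only [contract, LinearMap.applyₗ_apply_apply, LinearMap.smulRight_apply, smul_smul,
    ← Finset.sum_smul]
  simp only [T, hsum, Matrix.one_apply, ite_smul, one_smul, zero_smul, Finset.sum_ite_eq',
    Finset.mem_univ, if_true, LinearMap.id_apply]

theorem trace_eq_contract (hS : S.Nondegenerate) (f : Module.End ℝ E) :
    LinearMap.trace ℝ E f = contract S fun a b => S b (f a) := by
  have hf : f = contract S fun a b => (S b).smulRight (f a) := by
    calc f = LinearMap.mulLeft ℝ f (contract S fun a b => (S b).smulRight a) := by
          rw [contract_smulRight hS]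
          rfl
      _ = contract S fun a b => (S b).smulRight (f a) := by
          rw [map_contract]
          congr! 3 with _ b
          ext y
          simp
  refine (congrArg (LinearMap.trace ℝ E) hf).trans ?_
  rw [map_contract]
  simp only [LinearMap.trace_smulRight]

end Contraction

section CasimirTensor

variable {E W : Type*} [AddCommGroup E] [Module ℝ E] [FiniteDimensional ℝ E]
  [AddCommGroup W] [Module ℝ W] {S : LinearMap.BilinForm ℝ E}

/-- The tensor `g_{ab} T^a ⊗ T^b` inverse to a metric `S`. Every contraction with the inverse
metric of an expression bilinear in `T^a`, `T^b` is a linear image of it. -/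
def casimirTensor (S : LinearMap.BilinForm ℝ E) : E ⊗[ℝ] E := contract S fun a b => a ⊗ₜ b

theorem map_casimirTensor (f : E ⊗[ℝ] E →ₗ[ℝ] W) :
    f (casimirTensor S) = contract S fun a b => f (a ⊗ₜ b) :=
  map_contract f S _

theorem comm_casimirTensor (hS : S.IsSymm) :
    TensorProduct.comm ℝ E E (casimirTensor S) = casimirTensor S :=
  (map_casimirTensor (TensorProduct.comm ℝ E E).toLinearMap).trans (contract_flip hS _)

/-- The tensor `g_{ab} τ(T^a) ⊗ τ(T^b) / (2N)` of the Sugawara field for colours in the range of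
`τ` and the inverse `g_{ab}` of a metric `S`. -/
def sugawaraTensor (τ : E →ₗ[ℝ] W) (S : LinearMap.BilinForm ℝ E) (N : ℝ) : W ⊗[ℝ] W :=
  (1 / (2 * N)) • TensorProduct.map τ τ (casimirTensor S)

end CasimirTensor

section LieCasimirTensor

variable {E : Type*} [LieRing E] [LieAlgebra ℝ E] [FiniteDimensional ℝ E]
  {S : LinearMap.BilinForm ℝ E}

theorem lie_casimirTensor (hS : S.Nondegenerate) (hinv : S.lieInvariant E) (x : E) :
    ⁅x, casimirTensor S⁆ = 0 := by
  let F : E ⊗[ℝ] E ≃ₗ[ℝ] Module.End ℝ E := TensorProduct.comm ℝ E E ≪≫ₗ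
    TensorProduct.congr (S.toDual hS) (LinearEquiv.refl ℝ E) ≪≫ₗ dualTensorHomEquiv ℝ E E
  have F_tmul (a b : E) : F (a ⊗ₜ b) = (S b).smulRight a := by
    ext y
    simp [F, LinearMap.BilinForm.toDual_def]
  have F_casimir : F (casimirTensor S) = 1 := by
    refine (map_casimirTensor F.toLinearMap).trans ?_
    simp only [LinearEquiv.coe_coe, F_tmul]
    exact contract_smulRight hS
  have F_lie (t : E ⊗[ℝ] E) :
      F ⁅x, t⁆ = LieAlgebra.ad ℝ E x * F t - F t * LieAlgebra.ad ℝ E x := by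
    induction t with
    | zero => simp only [lie_zero, map_zero, mul_zero, zero_mul, sub_zero]
    | add s t hs ht =>
      rw [lie_add, map_add, map_add, hs, ht, mul_add, add_mul]
      abel
    | tmul a b =>
      ext y
      rw [TensorProduct.LieModule.lie_tmul_right, map_add, F_tmul, F_tmul, F_tmul]
      simp [hinv x b y, sub_eq_add_neg]
  apply F.injective
  rw [F_lie, F_casimir, map_zero, mul_one, one_mul, sub_self]

theorem contract_ad_mul_ad (hS : S.Nondegenerate) (hsymm : S.IsSymm) (hinv : S.lieInvariant E)
    {c : ℝ} (hkilling : killingForm ℝ E = c • S) :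
    contract S (fun a b => LieAlgebra.ad ℝ E a * LieAlgebra.ad ℝ E b) = c • 1 := by
  rw [← contract_flip hsymm]
  refine LinearMap.ext fun y => ?_
  set C : Module.End ℝ E :=
    contract S fun a b => LieAlgebra.ad ℝ E b * LieAlgebra.ad ℝ E a
  have form_eq (x : E) : S x (C y) = S x ((c • (1 : Module.End ℝ E)) y) := by
    calc S x (C y) = contract S fun a b => S x ⁅b, ⁅a, y⁆⁆ :=
          map_contract (S x ∘ₗ LinearMap.applyₗ y) S _
      _ = contract S fun a b => S b ⁅x, ⁅y, a⁆⁆ := by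
          congr! 3 with a b
          rw [← neg_inj, ← hinv, ← hinv, ← lie_skew b x, ← lie_skew a y, map_neg, map_neg,
            LinearMap.neg_apply, neg_neg]
      _ = killingForm ℝ E x y := by
          rw [killingForm_apply_apply, trace_eq_contract hS]
          rfl
      _ = S x ((c • (1 : Module.End ℝ E)) y) := by simp [hkilling]
  refine LinearMap.ker_eq_bot.mp hS.ker_eq_bot ?_
  ext x
  rw [hsymm.eq (C y), form_eq, hsymm.eq x]

end LieCasimirTensor

section Metrics

variable {E F : Type*} [AddCommGroup E] [Module ℝ E] [AddCommGroup F] [Module ℝ F]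
  {B S : LinearMap.BilinForm ℝ E}

/-- A metric: a symmetric positive definite real bilinear form. -/
structure IsMetric (B : LinearMap.BilinForm ℝ E) : Prop where
  isSymm : B.IsSymm
  pos : ∀ x, x ≠ 0 → 0 < B x x

namespace IsMetric

theorem nonneg (hB : IsMetric B) (x : E) : 0 ≤ B x x := by
  rcases eq_or_ne x 0 with rfl | hx
  · simp
  · exact (hB.pos x hx).le

theorem eq_zero (hB : IsMetric B) {x : E} (hx : B x x = 0) : x = 0 :=
  not_not.mp fun h => (hB.pos x h).ne' hx

theorem nondegenerate (hB : IsMetric B) : B.Nondegenerate :=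
  ⟨fun x h => hB.eq_zero (h x), fun x h => hB.eq_zero (h x)⟩

theorem comp (hB : IsMetric B) {f : F →ₗ[ℝ] E} (hf : Function.Injective f) :
    IsMetric (B.comp f f) where
  isSymm := ⟨fun x y => hB.isSymm.eq (f x) (f y)⟩
  pos x hx := hB.pos (f x) ((map_ne_zero_iff f hf).mpr hx)

theorem smul (hB : IsMetric B) {c : ℝ} (hc : 0 < c) : IsMetric (c • B) where
  isSymm := ⟨fun x y => congrArg (c • ·) (hB.isSymm.eq x y)⟩
  pos x hx := mul_pos hc (hB.pos x hx)

/-- The inner product space structure defined by a metric. -/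
abbrev core (hB : IsMetric B) : InnerProductSpace.Core ℝ E where
  inner x y := B x y
  conj_inner_symm x y := hB.isSymm.eq y x
  re_inner_nonneg x := hB.nonneg x
  add_left x y z := by simp
  smul_left x y r := by simp
  definite x h := hB.eq_zero h

theorem exists_eigenvector [FiniteDimensional ℝ E] [Nontrivial E] (hB : IsMetric B)
    (hS : S.IsSymm) : ∃ (c : ℝ) (x : E), x ≠ 0 ∧ S x = c • B x := by
  let : NormedAddCommGroup E := hB.core.toNormedAddCommGroup
  let : InnerProductSpace ℝ E := InnerProductSpace.ofCore hB.core.toCore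
  let T : E →ₗ[ℝ] E := S.symmCompOfNondegenerate B hB.nondegenerate
  have form_T (x y : E) : B (T x) y = S x y :=
    S.symmCompOfNondegenerate_left_apply hB.nondegenerate y x
  have hT : T.IsSymmetric := fun x y => by
    change B (T x) y = B x (T y)
    rw [form_T, hB.isSymm.eq, form_T, hS.eq]
  obtain ⟨x, hx⟩ := hT.hasEigenvalue_iSup_of_finiteDimensional.exists_hasEigenvector
  set c : ℝ := ⨆ x : { x : E // x ≠ 0 }, RCLike.re (inner ℝ (T x) (x : E)) / ‖(x : E)‖ ^ 2
  have eigen_eq : T x = c • x := hx.apply_eq_smul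
  refine ⟨c, x, hx.2, LinearMap.ext fun y => ?_⟩
  rw [← form_T, eigen_eq, map_smul]

end IsMetric

end Metrics

section SimpleLieAlgebra

open LieAlgebra

variable {L W : Type*} [LieRing L] [LieAlgebra ℝ L] [AddCommGroup W] [Module ℝ W]

theorem eq_zero_of_map_lie_eq_zero [IsSimple ℝ L] (f : L →ₗ[ℝ] W)
    (hf : ∀ x y : L, f ⁅x, y⁆ = 0) : f = 0 := by
  let I : LieIdeal ℝ L := { f.ker with lie_mem := fun {x y : L} _ => hf x y }
  rcases IsSimple.eq_bot_or_eq_top I with h | h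
  · refine absurd ⟨fun x y => ?_⟩ (IsSimple.non_abelian (R := ℝ) (L := L))
    have : ⁅x, y⁆ ∈ I := hf x y
    rwa [h, LieSubmodule.mem_bot] at this
  · exact LinearMap.ext fun x => (h ▸ LieSubmodule.mem_top x : x ∈ I)

variable [FiniteDimensional ℝ L] [IsSimple ℝ L] {B S : LinearMap.BilinForm ℝ L}

theorem killingForm_neg_of_isMetric (hB : IsMetric B) (hinv : B.lieInvariant L) {x : L}
    (hx : x ≠ 0) : killingForm ℝ L x x < 0 := by
  let : NormedAddCommGroup L := hB.core.toNormedAddCommGroup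
  let : InnerProductSpace ℝ L := InnerProductSpace.ofCore hB.core.toCore
  let e := stdOrthonormalBasis ℝ L
  have trace_eq : killingForm ℝ L x x = -∑ i, B ⁅x, e i⁆ ⁅x, e i⁆ := by
    rw [killingForm_apply_apply, LinearMap.trace_eq_sum_inner _ e, ← Finset.sum_neg_distrib]
    refine Finset.sum_congr rfl fun i _ => ?_
    change B (e i) ⁅x, ⁅x, e i⁆⁆ = _
    rw [hinv, neg_neg]
  obtain ⟨i, hi⟩ : ∃ i, ⁅x, e i⁆ ≠ 0 := by
    by_contra! h
    have ad_eq_zero : ad ℝ L x = 0 := e.toBasis.ext fun i => by simpa using h i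
    have mem_center : x ∈ center ℝ L := (LieModule.mem_maxTrivSubmodule ℝ L L x).mpr fun y => by
      rw [← lie_skew, ← ad_apply (R := ℝ), ad_eq_zero, LinearMap.zero_apply, neg_zero]
    rw [center_eq_bot, LieSubmodule.mem_bot] at mem_center
    exact hx mem_center
  rw [trace_eq, neg_lt_zero]
  exact Finset.sum_pos' (fun j _ => hB.nonneg _) ⟨i, Finset.mem_univ i, hB.pos _ hi⟩

theorem exists_eq_smul_of_lieInvariant (hB : IsMetric B) (hBinv : B.lieInvariant L)
    (hS : S.IsSymm) (hSinv : S.lieInvariant L) : ∃ c : ℝ, S = c • B := by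
  have : Nontrivial L := IsSimple.nontrivial ℝ L
  obtain ⟨c, x, hx, hc⟩ := hB.exists_eigenvector hS
  refine ⟨c, sub_eq_zero.mp ?_⟩
  let I : LieIdeal ℝ L :=
    { (S - c • B).ker with
      lie_mem := fun {y z : L} (hz : (S - c • B) z = 0) => LinearMap.ext fun w => by
        have h : (S - c • B) z ⁅y, w⁆ = 0 := by rw [hz, LinearMap.zero_apply]
        calc (S - c • B) ⁅y, z⁆ w = -(S - c • B) z ⁅y, w⁆ := by
              simp [hSinv y z w, hBinv y z w, neg_add_eq_sub]
          _ = 0 := by rw [h, neg_zero] }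
  have hI : I = ⊤ := (IsSimple.eq_bot_or_eq_top I).resolve_left fun h => hx <| by
    have : x ∈ I := sub_eq_zero.mpr hc
    rwa [h, LieSubmodule.mem_bot] at this
  exact LinearMap.ext fun y => (hI ▸ LieSubmodule.mem_top y : y ∈ I)

end SimpleLieAlgebra

section NormForm

open LieAlgebra

variable (𝔨 : Type*) [LieRing 𝔨] [LieAlgebra ℝ 𝔨] [FiniteDimensional ℝ 𝔨] [IsSimple ℝ 𝔨]

theorem isSymm_normForm : (normForm 𝔨).IsSymm :=
  ⟨fun x y => congrArg _ (LieModule.traceForm_comm ℝ 𝔨 𝔨 x y)⟩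

theorem lieInvariant_normForm : (normForm 𝔨).lieInvariant 𝔨 := fun x y z => by
  rw [normForm, LinearMap.smul_apply, LinearMap.smul_apply, LinearMap.smul_apply,
    LinearMap.smul_apply, ← smul_neg]
  exact congrArg _ (LieModule.traceForm_lieInvariant ℝ 𝔨 𝔨 x y z)

variable {𝔨}

theorem isMetric_normForm (hcompact : ∀ x : 𝔨, x ≠ 0 → killingForm ℝ 𝔨 x x < 0) :
    IsMetric (normForm 𝔨) where
  isSymm := isSymm_normForm 𝔨
  pos x hx := mul_pos_of_neg_of_neg (neg_neg_of_pos (half_pos (rootSq_pos 𝔨 _))) (hcompact x hx)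

end NormForm

section WeightOperator

open LieAlgebra TensorProduct

variable {L : Type*} [LieRing L] [LieAlgebra ℝ L] {B : LinearMap.BilinForm ℝ L}

/-- The operator `x ↦ B(a, x) b + B(b, x) a - ⁅b, ⁅a, x⁆⁆` for `t = a ⊗ b`. If `B` is `k` times the
normalised metric, then it describes the action `J^x_{-1}Ω ↦ J^{Wx}_{-1}Ω` on the states of energy
one of the zero mode of the field `∑ₘ :J^a_m J^b_{n-m}:`. -/
def weightOperator (B : LinearMap.BilinForm ℝ L) : L ⊗[ℝ] L →ₗ[ℝ] Module.End ℝ L :=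
  TensorProduct.lift <|
    let R : L →ₗ[ℝ] L →ₗ[ℝ] Module.End ℝ L := LinearMap.smulRightₗ ∘ₗ B
    R + R.flip - (LinearMap.mul ℝ (Module.End ℝ L)).flip.compl₁₂ (ad ℝ L) (ad ℝ L)

theorem weightOperator_tmul (a b : L) :
    weightOperator B (a ⊗ₜ b) =
      (B a).smulRight b + (B b).smulRight a - ad ℝ L b * ad ℝ L a :=
  rfl

theorem weightOperator_tmul_apply (a b x : L) :
    weightOperator B (a ⊗ₜ b) x = B a x • b + B b x • a - ⁅b, ⁅a, x⁆⁆ :=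
  rfl

theorem weightOperator_lie (hinv : B.lieInvariant L) (y : L) (t : L ⊗[ℝ] L) :
    weightOperator B ⁅y, t⁆ =
      ad ℝ L y * weightOperator B t - weightOperator B t * ad ℝ L y := by
  induction t with
  | zero => simp only [lie_zero, map_zero, mul_zero, zero_mul, sub_zero]
  | add s t hs ht =>
    rw [lie_add, map_add, map_add, hs, ht, mul_add, add_mul]
    abel
  | tmul a b =>
    ext x
    simp only [LieModule.lie_tmul_right, map_add, weightOperator_tmul_apply, LinearMap.add_apply,
      LinearMap.sub_apply, Module.End.mul_apply, ad_apply, hinv y, lie_add, lie_sub, lie_smul,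
      lie_lie y, neg_smul]
    abel

theorem form_weightOperator_left (hsymm : B.IsSymm) (hinv : B.lieInvariant L) (t : L ⊗[ℝ] L)
    (x y : L) :
    B (weightOperator B t x) y = B x (weightOperator B (TensorProduct.comm ℝ L L t) y) := by
  induction t with
  | zero => simp only [map_zero, LinearMap.zero_apply]
  | add s t hs ht => simp only [map_add, LinearMap.add_apply, hs, ht]
  | tmul a b =>
    have adjoint_eq : B ⁅b, ⁅a, x⁆⁆ y = B x ⁅a, ⁅b, y⁆⁆ := by rw [hinv, hinv, neg_neg]
    simp only [comm_tmul, weightOperator_tmul_apply, map_add, map_sub, map_smul,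
      LinearMap.add_apply, LinearMap.sub_apply, LinearMap.smul_apply, smul_eq_mul, adjoint_eq,
      hsymm.eq a x, hsymm.eq b x]
    ring

variable {E : Type*} [LieRing E] [LieAlgebra ℝ E]

theorem weightOperator_map_apply (τ : E →ₗ⁅ℝ⁆ L) (w : E ⊗[ℝ] E) (y : E) :
    weightOperator B (TensorProduct.map (τ : E →ₗ[ℝ] L) (τ : E →ₗ[ℝ] L) w) (τ y) =
      τ (weightOperator (B.comp (τ : E →ₗ[ℝ] L) (τ : E →ₗ[ℝ] L)) w y) := by
  induction w with
  | zero => simp only [map_zero, LinearMap.zero_apply]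
  | add v w hv hw => simp only [map_add, LinearMap.add_apply, hv, hw]
  | tmul a b =>
    simp only [map_tmul, weightOperator_tmul_apply, map_add, map_sub, map_smul, LieHom.map_lie]
    rfl

theorem map_lie_tensor (τ : E →ₗ⁅ℝ⁆ L) (x : E) (w : E ⊗[ℝ] E) :
    TensorProduct.map (τ : E →ₗ[ℝ] L) (τ : E →ₗ[ℝ] L) ⁅x, w⁆ =
      ⁅τ x, TensorProduct.map (τ : E →ₗ[ℝ] L) (τ : E →ₗ[ℝ] L) w⁆ := by
  induction w with
  | zero => simp only [lie_zero, map_zero]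
  | add v w hv hw => rw [lie_add, map_add, map_add, lie_add, hv, hw]
  | tmul a b => simp [LieModule.lie_tmul_right]

variable [FiniteDimensional ℝ E] {S : LinearMap.BilinForm ℝ E}

theorem weightOperator_map_casimirTensor (hS : S.IsSymm) (τ : E →ₗ[ℝ] L) :
    weightOperator B (TensorProduct.map τ τ (casimirTensor S)) =
      (2 : ℝ) • contract S (fun a b => (B (τ b)).smulRight (τ a)) -
        contract S fun a b => ad ℝ L (τ a) * ad ℝ L (τ b) := by
  calc weightOperator B (TensorProduct.map τ τ (casimirTensor S))
      = contract S fun a b => weightOperator B (τ a ⊗ₜ τ b) :=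
        map_casimirTensor (weightOperator B ∘ₗ TensorProduct.map τ τ)
    _ = contract S (fun a b => (B (τ a)).smulRight (τ b)) +
          contract S (fun a b => (B (τ b)).smulRight (τ a)) -
          contract S fun a b => ad ℝ L (τ b) * ad ℝ L (τ a) := by
        simp only [weightOperator_tmul, contract, smul_add, smul_sub, Finset.sum_add_distrib,
          Finset.sum_sub_distrib]
    _ = _ := by
        rw [contract_flip hS fun a b => (B (τ b)).smulRight (τ a),
          contract_flip hS fun a b => ad ℝ L (τ a) * ad ℝ L (τ b), two_smul]

end WeightOperator

section SugawaraTensor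

open LieAlgebra TensorProduct

variable {L : Type*} [LieRing L] [LieAlgebra ℝ L] {B : LinearMap.BilinForm ℝ L}

/-- The properties of a symmetric tensor `t` with colours in a subalgebra `U` which make the
quadratic field with tensor `t` a stress-energy tensor for the currents of `U`: it is `U`-invariant
and its weight operator is the identity on `U`, so that these currents are primary fields of weight
one. -/
structure IsSugawaraTensor (B : LinearMap.BilinForm ℝ L) (U : Submodule ℝ L) (t : L ⊗[ℝ] L) :
    Prop where
  symm : TensorProduct.comm ℝ L L t = t
  mem_map₂ : t ∈ Submodule.map₂ (TensorProduct.mk ℝ L L) U U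
  lie_eq_zero : ∀ u ∈ U, ⁅u, t⁆ = 0
  weight_eq : ∀ u ∈ U, weightOperator B t u = u

theorem lie_eq_zero_of_mem_map₂ {U : Submodule ℝ L} {u : L} (hu : ∀ x ∈ U, ⁅u, x⁆ = 0)
    {t : L ⊗[ℝ] L} (ht : t ∈ Submodule.map₂ (TensorProduct.mk ℝ L L) U U) : ⁅u, t⁆ = 0 := by
  suffices h : Submodule.map₂ (TensorProduct.mk ℝ L L) U U ≤
      (LieModule.toEnd ℝ L (L ⊗[ℝ] L) u).ker from h ht
  refine Submodule.map₂_le.mpr fun a ha b hb => ?_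
  change ⁅u, a ⊗ₜ[ℝ] b⁆ = 0
  rw [LieModule.lie_tmul_right, hu a ha, hu b hb, zero_tmul, tmul_zero, add_zero]

theorem weightOperator_eq_zero_of_mem_map₂ {U : Submodule ℝ L} {u : L}
    (hlie : ∀ x ∈ U, ⁅x, u⁆ = 0) (horth : ∀ x ∈ U, B x u = 0) {t : L ⊗[ℝ] L}
    (ht : t ∈ Submodule.map₂ (TensorProduct.mk ℝ L L) U U) : weightOperator B t u = 0 := by
  suffices h : Submodule.map₂ (TensorProduct.mk ℝ L L) U U ≤
      (LinearMap.applyₗ u ∘ₗ weightOperator B).ker from h ht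
  refine Submodule.map₂_le.mpr fun a ha b hb => ?_
  change weightOperator B (a ⊗ₜ b) u = 0
  rw [weightOperator_tmul_apply, hlie a ha, horth a ha, horth b hb, lie_zero, zero_smul,
    zero_smul, add_zero, sub_zero]

theorem IsSugawaraTensor.sum {ι : Type*} [Fintype ι] {U : ι → Submodule ℝ L}
    {t : ι → L ⊗[ℝ] L} (ht : ∀ i, IsSugawaraTensor B (U i) (t i))
    (hlie : ∀ i j, i ≠ j → ∀ x ∈ U i, ∀ y ∈ U j, ⁅x, y⁆ = 0)
    (horth : ∀ i j, i ≠ j → ∀ x ∈ U i, ∀ y ∈ U j, B x y = 0) :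
    IsSugawaraTensor B (⨆ i, U i) (∑ i, t i) := by
  classical
  have lie_eq (i j) (u) (hu : u ∈ U j) : ⁅u, t i⁆ = 0 := by
    rcases eq_or_ne i j with rfl | hij
    · exact (ht i).lie_eq_zero u hu
    · exact lie_eq_zero_of_mem_map₂ (fun x hx => hlie j i hij.symm u hu x hx) (ht i).mem_map₂
  have weight_eq (i j) (u) (hu : u ∈ U j) :
      weightOperator B (t i) u = if i = j then u else 0 := by
    split_ifs with hij
    · exact (ht i).weight_eq u (hij ▸ hu)
    · exact weightOperator_eq_zero_of_mem_map₂ (fun x hx => hlie i j hij x hx u hu)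
        (fun x hx => horth i j hij x hx u hu) (ht i).mem_map₂
  refine ⟨?_, ?_, fun u hu => ?_, fun u hu => ?_⟩
  · rw [map_sum]
    exact Finset.sum_congr rfl fun i _ => (ht i).symm
  · exact Submodule.sum_mem _ fun i _ =>
      Submodule.map₂_le_map₂ (le_iSup U i) (le_iSup U i) (ht i).mem_map₂
  · induction hu using Submodule.iSup_induction' with
    | mem j u hu => rw [lie_sum, Finset.sum_eq_zero fun i _ => lie_eq i j u hu]
    | zero => exact zero_lie _
    | add u v _ _ hu hv => rw [add_lie, hu, hv, add_zero]
  · induction hu using Submodule.iSup_induction' with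
    | mem j u hu => simp [LinearMap.sum_apply, weight_eq _ j u hu]
    | zero => exact map_zero _
    | add u v _ _ hu hv => rw [map_add, hu, hv]

variable {E : Type*} [LieRing E] [LieAlgebra ℝ E] [FiniteDimensional ℝ E]
  {S : LinearMap.BilinForm ℝ E}

theorem weightOperator_casimirTensor (hS : S.Nondegenerate) (hsymm : S.IsSymm)
    (hinv : S.lieInvariant E) {v : ℝ} (hkilling : killingForm ℝ E = (-(2 * v)) • S) (κ : ℝ) :
    weightOperator (κ • S) (casimirTensor S) = (2 * (κ + v)) • 1 := by
  have contract_smulRight_smul :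
      contract S (fun a b => ((κ • S) b).smulRight a) = κ • (1 : Module.End ℝ E) := by
    rw [Module.End.one_eq_id, ← contract_smulRight hS]
    exact contract_smul_smulRight κ S id
  have h := weightOperator_map_casimirTensor (B := κ • S) hsymm LinearMap.id
  rw [TensorProduct.map_id] at h
  refine h.trans ?_
  simp only [LinearMap.id_apply]
  rw [contract_ad_mul_ad hS hsymm hinv hkilling, contract_smulRight_smul, smul_smul, ← sub_smul]
  congr 1
  ring

theorem isSugawaraTensor_sugawaraTensor (hS : S.Nondegenerate) (hsymm : S.IsSymm)
    (hinv : S.lieInvariant E) (τ : E →ₗ⁅ℝ⁆ L) {κ v : ℝ}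
    (hB : B.comp (τ : E →ₗ[ℝ] L) (τ : E →ₗ[ℝ] L) = κ • S)
    (hkilling : killingForm ℝ E = (-(2 * v)) • S) (hne : κ + v ≠ 0) :
    IsSugawaraTensor B (LinearMap.range (τ : E →ₗ[ℝ] L))
      (sugawaraTensor (τ : E →ₗ[ℝ] L) S (κ + v)) := by
  have weight_casimir := weightOperator_casimirTensor hS hsymm hinv hkilling κ
  refine ⟨?_, ?_, ?_, ?_⟩
  · rw [sugawaraTensor, map_smul, ← map_comm, comm_casimirTensor hsymm]
  · rw [← range_map]
    exact Submodule.smul_mem _ _ ⟨_, rfl⟩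
  · rintro _ ⟨x, rfl⟩
    rw [sugawaraTensor, lie_smul]
    refine smul_eq_zero_of_right _ ?_
    exact (map_lie_tensor τ x _).symm.trans (by rw [lie_casimirTensor hS hinv, map_zero])
  · rintro _ ⟨x, rfl⟩
    rw [sugawaraTensor, map_smul, LinearMap.smul_apply, LieHom.coe_toLinearMap,
      weightOperator_map_apply, hB, weight_casimir, LinearMap.smul_apply, Module.End.one_apply,
      map_smul, smul_smul, one_div_mul_cancel (mul_ne_zero two_ne_zero hne), one_smul]

end SugawaraTensor

section Currents

variable {𝔤 : Type*} [LieRing 𝔤] [LieAlgebra ℝ 𝔤] [FiniteDimensional ℝ 𝔤]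
  [LieAlgebra.IsSimple ℝ 𝔤] {k : ℕ} {V : Type*} [NormedAddCommGroup V] [InnerProductSpace ℂ V]

variable (𝔤 k) in
/-- The invariant form `k (·, ·)_𝔤` occurring in the central term of the current algebra at
level `k`. -/
def levelForm : LinearMap.BilinForm ℝ 𝔤 := (k : ℝ) • normForm 𝔤

theorem isSymm_levelForm : (levelForm 𝔤 k).IsSymm where
  eq x y := congrArg _ ((isSymm_normForm 𝔤).eq x y)

theorem lieInvariant_levelForm : (levelForm 𝔤 k).lieInvariant 𝔤 := fun x y z => by
  simp only [levelForm, LinearMap.smul_apply, lieInvariant_normForm 𝔤 x y z, smul_neg]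

namespace VacuumCurrents

variable (A : VacuumCurrents 𝔤 k V)

theorem lie_J (x y : 𝔤) (m n : ℤ) :
    ⁅A.J x m, A.J y n⁆ = Complex.I • A.J ⁅x, y⁆ (m + n) +
      (if m + n = 0 then ((m * levelForm 𝔤 k x y : ℝ) : ℂ) else 0) • 1 := by
  rw [Ring.lie_def, A.commutator, levelForm, LinearMap.smul_apply, LinearMap.smul_apply,
    smul_eq_mul, mul_left_comm, mul_assoc]

theorem J_apply_J (x y : 𝔤) (m n : ℤ) (φ : V) :
    A.J x m (A.J y n φ) = A.J y n (A.J x m φ) + Complex.I • A.J ⁅x, y⁆ (m + n) φ +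
      (if m + n = 0 then ((m * levelForm 𝔤 k x y : ℝ) : ℂ) else 0) • φ := by
  have h := congrArg (· φ) (A.lie_J x y m n)
  simp only [Ring.lie_def, LinearMap.sub_apply, Module.End.mul_apply, LinearMap.add_apply,
    LinearMap.smul_apply, Module.End.one_apply] at h
  rw [add_assoc, ← h, add_sub_cancel]

theorem exists_forall_J_eq_zero (φ : V) : ∃ N : ℤ, ∀ m, N ≤ m → ∀ x, A.J x m φ = 0 := by
  let W : Submodule ℂ V :=
    { carrier := {φ | ∃ N : ℤ, ∀ m, N ≤ m → ∀ x, A.J x m φ = 0}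
      add_mem' := by
        rintro φ ψ ⟨M, hM⟩ ⟨N, hN⟩
        refine ⟨max M N, fun m hm x => ?_⟩
        rw [map_add, hM m (le_of_max_le_left hm), hN m (le_of_max_le_right hm), add_zero]
      zero_mem' := ⟨0, fun m _ x => map_zero _⟩
      smul_mem' := by
        rintro c φ ⟨N, hN⟩
        exact ⟨N, fun m hm x => by rw [map_smul, hN m hm, smul_zero]⟩ }
  have hW : W = ⊤ := by
    refine A.cyclic W ⟨0, fun m hm x => A.annihilation x m hm⟩ ?_
    rintro y n φ ⟨N, hN⟩
    refine ⟨max N (max (N - n) (1 - n)), fun m hm x => ?_⟩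
    simp only [sup_le_iff] at hm
    rw [J_apply_J, hN m hm.1, hN (m + n) (by lia), if_neg (by lia), map_zero, smul_zero, zero_smul,
      add_zero, add_zero]
  exact (hW ▸ Submodule.mem_top : φ ∈ W)

/-- The smallest subspace `S` containing the vacuum and stable under creation operators is stable
under all modes: by the commutation relations, so is the set of vectors which every mode maps
to `S`. -/
theorem eq_top_of_creation (W : Submodule ℂ V) (hΩ : A.Ω ∈ W)
    (hW : ∀ x n, n < 0 → ∀ φ ∈ W, A.J x n φ ∈ W) : W = ⊤ := by
  let S : Submodule ℂ V := sInf {W | A.Ω ∈ W ∧ ∀ x n, n < 0 → ∀ φ ∈ W, A.J x n φ ∈ W}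
  have vacuum_mem : A.Ω ∈ S := Submodule.mem_sInf.mpr fun W hW => hW.1
  have creation_mem (x n) (hn : n < 0) (φ) (hφ : φ ∈ S) : A.J x n φ ∈ S :=
    Submodule.mem_sInf.mpr fun W hW => hW.2 x n hn φ (Submodule.mem_sInf.mp hφ W hW)
  let S' : Submodule ℂ V := S ⊓ ⨅ (x : 𝔤) (n : ℤ), S.comap (A.J x n)
  have mem_S' {φ : V} : φ ∈ S' ↔ φ ∈ S ∧ ∀ x n, A.J x n φ ∈ S := by
    simp only [S', Submodule.mem_inf, Submodule.mem_iInf, Submodule.mem_comap]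
  have S_le_S' : S ≤ S' := by
    refine sInf_le ⟨mem_S'.mpr ⟨vacuum_mem, fun x n => ?_⟩, fun x n hn φ hφ => ?_⟩
    · rcases lt_or_ge n 0 with hn | hn
      · exact creation_mem x n hn _ vacuum_mem
      · rw [A.annihilation x n hn]
        exact S.zero_mem
    · obtain ⟨hφS, hJφ⟩ := mem_S'.mp hφ
      refine mem_S'.mpr ⟨hJφ x n, fun y m => ?_⟩
      rw [J_apply_J]
      exact S.add_mem (S.add_mem (creation_mem x n hn _ (hJφ y m)) (S.smul_mem _ (hJφ _ _)))
        (S.smul_mem _ hφS)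
  have S_eq_top : S = ⊤ :=
    A.cyclic S vacuum_mem fun x n φ hφ => (mem_S'.mp (S_le_S' hφ)).2 x n
  exact top_le_iff.mp (S_eq_top ▸ sInf_le ⟨hΩ, hW⟩)

theorem inner_J_neg_eq_zero {x : 𝔤} {ψ : V} (h : ∀ n, 0 < n → A.J x n ψ = 0) {n : ℤ} (hn : n < 0)
    (φ : V) : inner ℂ ψ (A.J x n φ) = 0 := by
  rw [← neg_neg n, ← A.hermitian, h (-n) (by lia), inner_zero_left]

theorem eq_zero_of_annihilated {ψ : V} (hΩ : inner ℂ ψ A.Ω = 0)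
    (h : ∀ x n, 0 < n → A.J x n ψ = 0) : ψ = 0 := by
  have orthogonal_eq_top : (ℂ ∙ ψ)ᗮ = ⊤ := by
    refine A.eq_top_of_creation _ (Submodule.mem_orthogonal_singleton_iff_inner_right.mpr hΩ) ?_
    exact fun x n hn φ _ => Submodule.mem_orthogonal_singleton_iff_inner_right.mpr <|
      A.inner_J_neg_eq_zero (h x) hn φ
  have self_mem : ψ ∈ (ℂ ∙ ψ)ᗮ := orthogonal_eq_top ▸ Submodule.mem_top
  exact inner_self_eq_zero.mp (Submodule.mem_orthogonal_singleton_iff_inner_right.mp self_mem)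

theorem J_J_neg_one_vacuum (x y : 𝔤) {n : ℤ} (hn : 0 < n) :
    A.J x n (A.J y (-1) A.Ω) = (if n = 1 then (levelForm 𝔤 k x y : ℂ) else 0) • A.Ω := by
  rw [J_apply_J, A.annihilation x n hn.le, A.annihilation _ (n + -1) (by lia), map_zero, smul_zero,
    zero_add, zero_add]
  split_ifs with h₁ h₂ h₂
  · rw [h₂, Int.cast_one, one_mul]
  all_goals lia

theorem eq_zero_of_J_neg_one_vacuum (hmetric : IsMetric (levelForm 𝔤 k)) {x : 𝔤}
    (h : A.J x (-1) A.Ω = 0) : x = 0 := by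
  have vacuum_ne_zero : A.Ω ≠ 0 := norm_ne_zero_iff.mp (A.norm_vacuum ▸ one_ne_zero)
  have norm_eq := A.J_J_neg_one_vacuum x x one_pos
  rw [h, map_zero, if_pos rfl, eq_comm, smul_eq_zero_iff_left vacuum_ne_zero,
    Complex.ofReal_eq_zero] at norm_eq
  exact hmetric.eq_zero norm_eq

/-- The `m`-th term of the `n`-th mode of the quadratic field with tensor `g_{ab} T^a ⊗ T^b`,
ordered as if the modes below `c` were the creation operators. -/
def quadTerm (c n m : ℤ) : 𝔤 ⊗[ℝ] 𝔤 →ₗ[ℝ] Module.End ℂ V :=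
  let mul := LinearMap.mul ℝ (Module.End ℂ V)
  TensorProduct.lift <| (if m < c then mul else mul.flip).compl₁₂
    (LinearMap.proj m ∘ₗ A.J) (LinearMap.proj (n - m) ∘ₗ A.J)

theorem quadTerm_tmul (c n m : ℤ) (x y : 𝔤) :
    A.quadTerm c n m (x ⊗ₜ y) =
      if m < c then A.J x m * A.J y (n - m) else A.J y (n - m) * A.J x m := by
  unfold quadTerm
  split_ifs <;> rfl

theorem hasFiniteSupport_quadTerm (c n : ℤ) (t : 𝔤 ⊗[ℝ] 𝔤) (φ : V) :
    (fun m => A.quadTerm c n m t φ).HasFiniteSupport := by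
  obtain ⟨N, hN⟩ := A.exists_forall_J_eq_zero φ
  refine (Set.finite_Icc (min (n - N) c) (max N c)).subset fun m => ?_
  contrapose
  intro hm
  rw [Set.mem_Icc, not_and_or, not_le, not_le] at hm
  rw [Function.notMem_support]
  induction t with
  | zero => rw [map_zero, LinearMap.zero_apply]
  | add s t hs ht => rw [map_add, LinearMap.add_apply, hs, ht, add_zero]
  | tmul x y =>
    rw [quadTerm_tmul]
    rcases hm with hm | hm
    · rw [if_pos (by lia), Module.End.mul_apply, hN (n - m) (by lia), map_zero]
    · rw [if_neg (by lia), Module.End.mul_apply, hN m (by lia), map_zero]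

/-- The `n`-th mode of the quadratic field with tensor `g_{ab} T^a ⊗ T^b`, ordered as if the modes
below `c` were the creation operators. Commutators with currents shift the cutoff `c`. -/
def quadCut (c n : ℤ) : 𝔤 ⊗[ℝ] 𝔤 →ₗ[ℝ] Module.End ℂ V where
  toFun t :=
    { toFun φ := ∑ᶠ m : ℤ, A.quadTerm c n m t φ
      map_add' φ ψ := by
        simp only [map_add]
        exact finsum_add_distrib (A.hasFiniteSupport_quadTerm c n t φ)
          (A.hasFiniteSupport_quadTerm c n t ψ)
      map_smul' c φ := by simp only [map_smul, smul_finsum, RingHom.id_apply] }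
  map_add' s t := LinearMap.ext fun φ => by
    simp only [map_add]
    exact finsum_add_distrib (A.hasFiniteSupport_quadTerm c n s φ)
      (A.hasFiniteSupport_quadTerm c n t φ)
  map_smul' a t := LinearMap.ext fun φ => by
    simp only [map_smul, RingHom.id_apply]
    exact (smul_finsum a fun m => A.quadTerm c n m t φ).symm

theorem quadCut_apply (c n : ℤ) (t : 𝔤 ⊗[ℝ] 𝔤) (φ : V) :
    A.quadCut c n t φ = ∑ᶠ m : ℤ, A.quadTerm c n m t φ :=
  rfl

/-- The `n`-th mode `∑ₘ g_{ab} :J^a_m J^b_{n-m}:` of the normal ordered quadratic field with tensor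
`g_{ab} T^a ⊗ T^b`. -/
abbrev quad (n : ℤ) : 𝔤 ⊗[ℝ] 𝔤 →ₗ[ℝ] Module.End ℂ V := A.quadCut 0 n

theorem quad_vacuum {n : ℤ} (hn : -1 ≤ n) (t : 𝔤 ⊗[ℝ] 𝔤) : A.quad n t A.Ω = 0 := by
  induction t with
  | zero => rw [map_zero, LinearMap.zero_apply]
  | add s t hs ht => rw [map_add, LinearMap.add_apply, hs, ht, add_zero]
  | tmul x y =>
    refine finsum_eq_zero_of_forall_eq_zero fun m => ?_
    rw [quadTerm_tmul]
    split_ifs with hm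
    · rw [Module.End.mul_apply, A.annihilation y (n - m) (by lia), map_zero]
    · rw [Module.End.mul_apply, A.annihilation x m (by lia), map_zero]

theorem inner_quad_eq_zero {U : Submodule ℝ 𝔤} {ψ : V}
    (hψ : ∀ u ∈ U, ∀ n, 0 < n → A.J u n ψ = 0) {t : 𝔤 ⊗[ℝ] 𝔤}
    (ht : t ∈ Submodule.map₂ (TensorProduct.mk ℝ 𝔤 𝔤) U U) {n : ℤ} (hn : n < 0) (φ : V) :
    inner ℂ ψ (A.quad n t φ) = 0 := by
  have termwise (m : ℤ) : inner ℂ ψ (A.quadTerm 0 n m t φ) = 0 := by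
    rw [Submodule.map₂_eq_span_image2] at ht
    induction ht using Submodule.span_induction with
    | mem t ht =>
      obtain ⟨u, hu, u', hu', rfl⟩ := ht
      simp only [TensorProduct.mk_apply, quadTerm_tmul]
      split_ifs with hm
      · exact A.inner_J_neg_eq_zero (hψ u hu) hm _
      · exact A.inner_J_neg_eq_zero (hψ u' hu') (by lia) _
    | zero => rw [map_zero, LinearMap.zero_apply, inner_zero_right]
    | add s t _ _ hs ht => rw [map_add, LinearMap.add_apply, inner_add_right, hs, ht, add_zero]
    | smul c t _ ht =>
      rw [map_smul, LinearMap.smul_apply, ← Complex.coe_smul, inner_smul_right, ht, mul_zero]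
  rw [quadCut_apply, finsum_eq_sum _ (A.hasFiniteSupport_quadTerm 0 n t φ), inner_sum]
  exact Finset.sum_eq_zero fun m _ => termwise m

end VacuumCurrents

end Currents

/-- The linear form `a ⊗ b ↦ B(⁅x, a⁆, b)`. It is the coefficient of the central term in the
commutators of the modes of the current `x` with those of a quadratic field. -/
def centralPart {L : Type*} [LieRing L] [LieAlgebra ℝ L] (B : LinearMap.BilinForm ℝ L) (x : L) :
    L ⊗[ℝ] L →ₗ[ℝ] ℝ :=
  TensorProduct.lift (B ∘ₗ (LieAlgebra.ad ℝ L x : L →ₗ[ℝ] L))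

theorem centralPart_eq_zero {L : Type*} [LieRing L] [LieAlgebra ℝ L] {B : LinearMap.BilinForm ℝ L}
    (hsymm : B.IsSymm) (hinv : B.lieInvariant L) {t : L ⊗[ℝ] L}
    (ht : TensorProduct.comm ℝ L L t = t) (x : L) : centralPart B x t = 0 := by
  have antisymm : centralPart B x ∘ₗ (TensorProduct.comm ℝ L L : L ⊗[ℝ] L →ₗ[ℝ] L ⊗[ℝ] L) =
      -centralPart B x := TensorProduct.ext' fun a b => by
    change B ⁅x, b⁆ a = -B ⁅x, a⁆ b
    rw [hinv, ← hsymm.eq]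
  have eq_neg := LinearMap.congr_fun antisymm t
  rw [LinearMap.comp_apply, LinearEquiv.coe_coe, ht, LinearMap.neg_apply] at eq_neg
  exact self_eq_neg.mp eq_neg

section Commutator

variable {𝔤 : Type*} [LieRing 𝔤] [LieAlgebra ℝ 𝔤] [FiniteDimensional ℝ 𝔤]
  [LieAlgebra.IsSimple ℝ 𝔤] {k : ℕ} {V : Type*} [NormedAddCommGroup V] [InnerProductSpace ℂ V]

namespace VacuumCurrents

variable (A : VacuumCurrents 𝔤 k V)

theorem quadCut_tmul_add_one (c n : ℤ) (a b : 𝔤) :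
    A.quadCut (c + 1) n (a ⊗ₜ b) = A.quadCut c n (a ⊗ₜ b) + ⁅A.J a c, A.J b (n - c)⁆ := by
  refine LinearMap.ext fun φ => ?_
  have term_sub (m : ℤ) : A.quadTerm (c + 1) n m (a ⊗ₜ b) φ - A.quadTerm c n m (a ⊗ₜ b) φ =
      if m = c then ⁅A.J a c, A.J b (n - c)⁆ φ else 0 := by
    rw [quadTerm_tmul, quadTerm_tmul]
    rcases lt_trichotomy m c with hm | rfl | hm
    · rw [if_pos (by lia), if_pos hm, if_neg hm.ne, sub_self]
    · rw [if_pos (by lia), if_neg (lt_irrefl m), if_pos rfl, Ring.lie_def, LinearMap.sub_apply]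
    · rw [if_neg (by lia), if_neg (by lia), if_neg hm.ne', sub_self]
  rw [LinearMap.add_apply, ← sub_eq_iff_eq_add', quadCut_apply, quadCut_apply,
    ← finsum_sub_distrib (A.hasFiniteSupport_quadTerm _ n _ φ)
      (A.hasFiniteSupport_quadTerm _ n _ φ), finsum_congr term_sub,
    finsum_eq_single _ c fun m hm => if_neg hm, if_pos rfl]

theorem quadCut_tmul (c n : ℤ) (a b : 𝔤) :
    A.quadCut c n (a ⊗ₜ b) = A.quad n (a ⊗ₜ b) + (c * Complex.I) • A.J ⁅a, b⁆ n +
      (if n = 0 then ((c * (c - 1) / 2 * levelForm 𝔤 k a b : ℝ) : ℂ) else 0) • 1 := by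
  let defect (c : ℤ) : Module.End ℂ V := A.quadCut c n (a ⊗ₜ b) - (c * Complex.I) • A.J ⁅a, b⁆ n -
    (if n = 0 then ((c * (c - 1) / 2 * levelForm 𝔤 k a b : ℝ) : ℂ) else 0) • 1
  have periodic : Function.Periodic defect 1 := fun c => by
    simp only [defect]
    rw [quadCut_tmul_add_one, lie_J, add_sub_cancel]
    split_ifs with hn
    · push_cast
      module
    · push_cast
      module
  have defect_eq := periodic.int_mul_eq c
  simp only [defect, mul_one, Int.cast_id] at defect_eq
  simp only [Int.cast_zero, zero_mul, zero_div, zero_smul, Complex.ofReal_zero, ite_self, sub_zero]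
    at defect_eq
  rw [← defect_eq]
  abel

theorem lie_quadTerm_tmul (x a b : 𝔤) (p c n m : ℤ) :
    ⁅A.J x p, A.quadTerm c n m (a ⊗ₜ b)⁆ =
      Complex.I • A.quadTerm c (n + p) m (a ⊗ₜ ⁅x, b⁆) +
      Complex.I • A.quadTerm (c + p) (n + p) (m + p) (⁅x, a⁆ ⊗ₜ b) +
      (if m = n + p then ((p * levelForm 𝔤 k x b : ℝ) : ℂ) • A.J a (n + p) else 0) +
      (if m = -p then ((p * levelForm 𝔤 k x a : ℝ) : ℂ) • A.J b (n + p) else 0) := by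
  have lie_mul (D F G : Module.End ℂ V) : ⁅D, F * G⁆ = ⁅D, F⁆ * G + F * ⁅D, G⁆ := by
    simp only [Ring.lie_def]
    noncomm_ring
  have central_right : (if p + (n - m) = 0 then ((p * levelForm 𝔤 k x b : ℝ) : ℂ) else 0) • A.J a m
      = if m = n + p then ((p * levelForm 𝔤 k x b : ℝ) : ℂ) • A.J a (n + p) else 0 := by
    split_ifs with h₁ h₂ h₂
    any_goals lia
    · rw [h₂]
    · rw [zero_smul]
  have central_left :
      (if p + m = 0 then ((p * levelForm 𝔤 k x a : ℝ) : ℂ) else 0) • A.J b (n - m)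
      = if m = -p then ((p * levelForm 𝔤 k x a : ℝ) : ℂ) • A.J b (n + p) else 0 := by
    split_ifs with h₁ h₂ h₂
    any_goals lia
    · rw [h₂, sub_neg_eq_add]
    · rw [zero_smul]
  have sub_right : n + p - m = p + (n - m) := by ring
  have sub_left : n + p - (p + m) = n - m := by ring
  have cutoff_iff : p + m < c + p ↔ m < c := by lia
  simp only [quadTerm_tmul, ← central_left, ← central_right, sub_left, sub_right, add_comm m p,
    cutoff_iff]
  by_cases hm : m < c <;>
  simp only [hm, if_true, if_false, lie_mul, lie_J, add_mul, mul_add, smul_mul_assoc,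
    mul_smul_comm, one_mul, mul_one] <;>
  abel

theorem lie_quadCut_apply (D : Module.End ℂ V) (c n : ℤ) (t : 𝔤 ⊗[ℝ] 𝔤) (φ : V) :
    ⁅D, A.quadCut c n t⁆ φ = ∑ᶠ m : ℤ, ⁅D, A.quadTerm c n m t⁆ φ := by
  have map_finsum : D (A.quadCut c n t φ) = ∑ᶠ m : ℤ, D (A.quadTerm c n m t φ) :=
    D.toAddMonoidHom.map_finsum (A.hasFiniteSupport_quadTerm c n t φ)
  simp only [Ring.lie_def, LinearMap.sub_apply, Module.End.mul_apply]
  rw [map_finsum, quadCut_apply]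
  exact (finsum_sub_distrib
    ((A.hasFiniteSupport_quadTerm c n t φ).subset fun m hm h => hm (by simp only [h, map_zero]))
    (A.hasFiniteSupport_quadTerm c n t (D φ))).symm

theorem finsum_quadTerm_add (c n p : ℤ) (t : 𝔤 ⊗[ℝ] 𝔤) (φ : V) :
    ∑ᶠ m : ℤ, A.quadTerm c n (m + p) t φ = A.quadCut c n t φ :=
  finsum_comp_equiv (Equiv.addRight p) (f := fun m => A.quadTerm c n m t φ)

theorem lie_quadCut_tmul (x a b : 𝔤) (p c n : ℤ) :
    ⁅A.J x p, A.quadCut c n (a ⊗ₜ b)⁆ =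
      Complex.I • A.quadCut c (n + p) (a ⊗ₜ ⁅x, b⁆) +
      Complex.I • A.quadCut (c + p) (n + p) (⁅x, a⁆ ⊗ₜ b) +
      ((p * levelForm 𝔤 k x b : ℝ) : ℂ) • A.J a (n + p) +
      ((p * levelForm 𝔤 k x a : ℝ) : ℂ) • A.J b (n + p) := by
  refine LinearMap.ext fun φ => ?_
  have single (q : ℤ) (F : Module.End ℂ V) :
      (fun m : ℤ => (if m = q then F else 0) φ).HasFiniteSupport ∧
        ∑ᶠ m : ℤ, (if m = q then F else 0) φ = F φ := by
    have eq_zero (m : ℤ) (hm : m ≠ q) : (if m = q then F else 0) φ = 0 := by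
      rw [if_neg hm, LinearMap.zero_apply]
    refine ⟨(Set.finite_singleton q).subset fun m hm => not_imp_comm.mp (eq_zero m) hm, ?_⟩
    rw [finsum_eq_single _ q eq_zero, if_pos rfl]
  have finite_right := A.hasFiniteSupport_quadTerm c (n + p) (a ⊗ₜ ⁅x, b⁆) φ
  have finite_left :
      (fun m => A.quadTerm (c + p) (n + p) (m + p) (⁅x, a⁆ ⊗ₜ b) φ).HasFiniteSupport :=
    (A.hasFiniteSupport_quadTerm _ _ _ φ).preimage (add_left_injective p).injOn
  have finite_a := (single (n + p) (((p * levelForm 𝔤 k x b : ℝ) : ℂ) • A.J a (n + p))).1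
  have finite_b := (single (-p) (((p * levelForm 𝔤 k x a : ℝ) : ℂ) • A.J b (n + p))).1
  rw [lie_quadCut_apply]
  simp only [lie_quadTerm_tmul, LinearMap.add_apply, LinearMap.smul_apply]
  rw [finsum_add_distrib, finsum_add_distrib, finsum_add_distrib, ← smul_finsum, ← smul_finsum,
    finsum_quadTerm_add, (single _ _).2, (single _ _).2]
  · rfl
  all_goals fun_prop

theorem lie_J_quad (x : 𝔤) (t : 𝔤 ⊗[ℝ] 𝔤) (p n : ℤ) :
    ⁅A.J x p, A.quad n t⁆ = Complex.I • A.quad (n + p) ⁅x, t⁆ +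
      (p : ℂ) • A.J (weightOperator (levelForm 𝔤 k) t x) (n + p) +
      (if n + p = 0 then (p * (p - 1) / 2 * Complex.I) * centralPart (levelForm 𝔤 k) x t else 0) •
        1 := by
  induction t with
  | zero =>
    simp only [lie_zero, map_zero, LinearMap.zero_apply, Pi.zero_apply, smul_zero,
      Complex.ofReal_zero, mul_zero, ite_self, zero_smul, add_zero, Ring.lie_def, zero_mul,
      sub_self]
  | add s t hs ht =>
    rw [map_add, Ring.lie_def, mul_add, add_mul, add_sub_add_comm, ← Ring.lie_def, ← Ring.lie_def,
      hs, ht]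
    simp only [lie_add, map_add, LinearMap.add_apply, Pi.add_apply, Complex.ofReal_add]
    split_ifs <;> module
  | tmul a b =>
    have centralPart_tmul : centralPart (levelForm 𝔤 k) x (a ⊗ₜ b) = levelForm 𝔤 k ⁅x, a⁆ b := rfl
    have J_smul (r : ℝ) (y : 𝔤) : A.J (r • y) (n + p) = (r : ℂ) • A.J y (n + p) := by
      rw [map_smul, Pi.smul_apply, Complex.coe_smul]
    have lie_lie_eq : ⁅b, ⁅a, x⁆⁆ = ⁅⁅x, a⁆, b⁆ := by rw [← lie_skew, ← lie_skew x a, neg_lie]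
    have I_smul (F : Module.End ℂ V) : Complex.I • (p * Complex.I) • F = -((p : ℂ) • F) := by
      rw [smul_smul, mul_left_comm, Complex.I_mul_I, mul_neg_one, neg_smul]
    rw [lie_quadCut_tmul, zero_add, A.quadCut_tmul p, smul_add, smul_add, I_smul,
      weightOperator_tmul_apply, map_sub, map_add, Pi.sub_apply, Pi.add_apply, J_smul, J_smul,
      centralPart_tmul, TensorProduct.LieModule.lie_tmul_right, map_add, lie_lie_eq,
      isSymm_levelForm.eq a x, isSymm_levelForm.eq b x]
    split_ifs <;> push_cast <;> module

theorem J_apply_quad {t : 𝔤 ⊗[ℝ] 𝔤} (ht : TensorProduct.comm ℝ 𝔤 𝔤 t = t) (x : 𝔤) (p n : ℤ)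
    (φ : V) :
    A.J x p (A.quad n t φ) = A.quad n t (A.J x p φ) + Complex.I • A.quad (n + p) ⁅x, t⁆ φ +
      (p : ℂ) • A.J (weightOperator (levelForm 𝔤 k) t x) (n + p) φ := by
  have lie_eq := congrArg (· φ) (A.lie_J_quad x t p n)
  simp only [Ring.lie_def, centralPart_eq_zero isSymm_levelForm lieInvariant_levelForm ht,
    Complex.ofReal_zero, mul_zero, ite_self, zero_smul, add_zero, LinearMap.sub_apply,
    Module.End.mul_apply, LinearMap.add_apply, LinearMap.smul_apply] at lie_eq
  rw [add_assoc, ← lie_eq, add_sub_cancel]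

theorem quad_J_neg_one_vacuum {t : 𝔤 ⊗[ℝ] 𝔤} (ht : TensorProduct.comm ℝ 𝔤 𝔤 t = t) (x : 𝔤) {n : ℤ}
    (hn : -1 ≤ n) :
    A.quad n t (A.J x (-1) A.Ω) = A.J (weightOperator (levelForm 𝔤 k) t x) (n - 1) A.Ω -
      Complex.I • A.quad (n - 1) ⁅x, t⁆ A.Ω := by
  have J_quad_eq := A.J_apply_quad ht x (-1) n A.Ω
  rw [A.quad_vacuum hn, map_zero, Int.cast_neg, Int.cast_one, neg_one_smul, ← sub_eq_add_neg,
    ← sub_eq_add_neg, eq_comm, sub_eq_zero] at J_quad_eq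
  exact eq_sub_of_add_eq J_quad_eq

end VacuumCurrents

end Commutator

section Vanishing

theorem comm_lie_tensor {L : Type*} [LieRing L] [LieAlgebra ℝ L] (y : L) (t : L ⊗[ℝ] L) :
    TensorProduct.comm ℝ L L ⁅y, t⁆ = ⁅y, TensorProduct.comm ℝ L L t⁆ := by
  induction t with
  | zero => simp only [lie_zero, map_zero]
  | add s t hs ht => simp only [lie_add, map_add, hs, ht]
  | tmul a b =>
    simp only [TensorProduct.LieModule.lie_tmul_right, map_add, TensorProduct.comm_tmul]
    exact add_comm _ _

variable {𝔤 : Type*} [LieRing 𝔤] [LieAlgebra ℝ 𝔤] [FiniteDimensional ℝ 𝔤]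
  [LieAlgebra.IsSimple ℝ 𝔤] {k : ℕ} {V : Type*} [NormedAddCommGroup V] [InnerProductSpace ℂ V]

/-- The symmetric tensors whose quadratic field has commutators with the currents without a linear
term. These tensors form a subrepresentation. -/
structure IsWeightless (k : ℕ) (t : 𝔤 ⊗[ℝ] 𝔤) : Prop where
  symm : TensorProduct.comm ℝ 𝔤 𝔤 t = t
  weight_eq_zero : weightOperator (levelForm 𝔤 k) t = 0

theorem IsWeightless.lie {t : 𝔤 ⊗[ℝ] 𝔤} (ht : IsWeightless k t) (y : 𝔤) :
    IsWeightless k ⁅y, t⁆ where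
  symm := by rw [comm_lie_tensor, ht.symm]
  weight_eq_zero := by
    rw [weightOperator_lie lieInvariant_levelForm, ht.weight_eq_zero, mul_zero, zero_mul, sub_zero]

namespace VacuumCurrents

variable (A : VacuumCurrents 𝔤 k V)

theorem J_apply_quad_of_isWeightless {t : 𝔤 ⊗[ℝ] 𝔤} (ht : IsWeightless k t) (x : 𝔤) (p n : ℤ)
    (φ : V) :
    A.J x p (A.quad n t φ) = A.quad n t (A.J x p φ) + Complex.I • A.quad (n + p) ⁅x, t⁆ φ := by
  rw [A.J_apply_quad ht.symm, ht.weight_eq_zero, LinearMap.zero_apply, map_zero, Pi.zero_apply,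
    LinearMap.zero_apply, smul_zero, add_zero]

theorem inner_vacuum_quad_vacuum (t : 𝔤 ⊗[ℝ] 𝔤) {n : ℤ} (hn : n < 0) :
    inner ℂ (A.quad n t A.Ω) A.Ω = 0 := by
  refine inner_eq_zero_symm.mp (A.inner_quad_eq_zero (U := ⊤)
    (fun u _ p hp => A.annihilation u p hp.le) ?_ hn A.Ω)
  rw [TensorProduct.map₂_mk_top_top_eq_top]
  trivial

/-- The positive modes `A.J x p` raise the mode number `n`, from which the induction descends. -/
theorem quad_vacuum_of_isWeightless {t : 𝔤 ⊗[ℝ] 𝔤} (ht : IsWeightless k t) (n : ℤ) :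
    A.quad n t A.Ω = 0 := by
  obtain ⟨j, hj⟩ : ∃ j : ℕ, -1 - (j : ℤ) ≤ n := ⟨n.natAbs, by lia⟩
  induction j generalizing n t with
  | zero => exact A.quad_vacuum (by lia) t
  | succ j ih =>
    rcases le_or_gt (-1) n with hn | hn
    · exact A.quad_vacuum hn t
    refine A.eq_zero_of_annihilated (A.inner_vacuum_quad_vacuum t (by lia)) fun x p hp => ?_
    rw [A.J_apply_quad_of_isWeightless ht, A.annihilation x p hp.le, map_zero,
      ih (ht.lie x) (n + p) (by lia), smul_zero, add_zero]

theorem quad_eq_zero_of_isWeightless {t : 𝔤 ⊗[ℝ] 𝔤} (ht : IsWeightless k t) (n : ℤ) :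
    A.quad n t = 0 := by
  let W : Submodule ℂ V :=
    { carrier := {φ | ∀ (n : ℤ) (t : 𝔤 ⊗[ℝ] 𝔤), IsWeightless k t → A.quad n t φ = 0}
      add_mem' := fun hφ hψ n t ht => by rw [map_add, hφ n t ht, hψ n t ht, add_zero]
      zero_mem' := fun n t _ => map_zero _
      smul_mem' := fun c φ hφ n t ht => by rw [map_smul, hφ n t ht, smul_zero] }
  have hW : W = ⊤ := by
    refine A.cyclic W (fun n t ht => A.quad_vacuum_of_isWeightless ht n) fun x p φ hφ n t ht => ?_
    have J_quad_eq := A.J_apply_quad_of_isWeightless ht x p n φ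
    rw [hφ n t ht, hφ (n + p) _ (ht.lie x), map_zero, smul_zero, add_zero] at J_quad_eq
    exact J_quad_eq.symm
  exact LinearMap.ext fun φ => (hW ▸ Submodule.mem_top : φ ∈ W) n t ht

theorem forall_quad_eq_zero_iff (hmetric : IsMetric (levelForm 𝔤 k)) {t : 𝔤 ⊗[ℝ] 𝔤}
    (ht : TensorProduct.comm ℝ 𝔤 𝔤 t = t) :
    (∀ n, A.quad n t = 0) ↔ weightOperator (levelForm 𝔤 k) t = 0 := by
  refine ⟨fun h => LinearMap.ext fun x => ?_, fun h => A.quad_eq_zero_of_isWeightless ⟨ht, h⟩⟩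
  have quad_eq := A.quad_J_neg_one_vacuum ht x (n := 0) (by lia)
  rw [h, LinearMap.zero_apply, A.quad_vacuum (by lia), smul_zero, sub_zero] at quad_eq
  exact A.eq_zero_of_J_neg_one_vacuum hmetric quad_eq.symm

theorem forall_quad_eq_iff (hmetric : IsMetric (levelForm 𝔤 k)) {s t : 𝔤 ⊗[ℝ] 𝔤}
    (hs : TensorProduct.comm ℝ 𝔤 𝔤 s = s) (ht : TensorProduct.comm ℝ 𝔤 𝔤 t = t) :
    (∀ n, A.quad n s = A.quad n t) ↔
      weightOperator (levelForm 𝔤 k) s = weightOperator (levelForm 𝔤 k) t := by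
  have symm_sub : TensorProduct.comm ℝ 𝔤 𝔤 (s - t) = s - t := by rw [map_sub, hs, ht]
  simpa only [map_sub, sub_eq_zero] using A.forall_quad_eq_zero_iff hmetric symm_sub

theorem J_two_quad_neg_one {t : 𝔤 ⊗[ℝ] 𝔤} (ht : TensorProduct.comm ℝ 𝔤 𝔤 t = t) (x : 𝔤) :
    A.J x 2 (A.quad (-1) t (A.J x (-1) A.Ω)) =
      ((2 * levelForm 𝔤 k (weightOperator (levelForm 𝔤 k) t x) x : ℝ) : ℂ) • A.Ω := by
  have symm_lie : TensorProduct.comm ℝ 𝔤 𝔤 ⁅x, t⁆ = ⁅x, t⁆ := by rw [comm_lie_tensor, ht]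
  have quad_lie_eq_zero : A.quad 1 ⁅x, t⁆ (A.J x (-1) A.Ω) = 0 := by
    rw [A.quad_J_neg_one_vacuum symm_lie x (by lia), A.annihilation _ _ (by lia),
      A.quad_vacuum (by lia), smul_zero, sub_zero]
  rw [A.J_apply_quad ht, A.J_J_neg_one_vacuum x x two_pos, if_neg (by lia), zero_smul, map_zero,
    show (-1 + 2 : ℤ) = 1 by rfl, quad_lie_eq_zero, smul_zero, zero_add, zero_add,
    A.J_J_neg_one_vacuum _ _ one_pos, if_pos rfl, smul_smul, Int.cast_two,
    Complex.ofReal_mul, Complex.ofReal_ofNat]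

/-- The difference of the two stress-energy tensors is the coset stress-energy tensor, whose modes
commute with the currents of `U`. Hence its mode `-1`, applied to the vector `J x (-1) Ω`, gives
a vector `ψ` which is orthogonal to the contribution of `r`, so that
`⟨ψ, ψ⟩ = ⟨ψ, J x (-2) Ω⟩ = ⟨J x 2 ψ, Ω⟩`. -/
theorem form_weightOperator_le (A : VacuumCurrents 𝔤 k V) {U : Submodule ℝ 𝔤} {r s : 𝔤 ⊗[ℝ] 𝔤}
    (hs : IsSugawaraTensor (levelForm 𝔤 k) ⊤ s) (hr : IsSugawaraTensor (levelForm 𝔤 k) U r)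
    (x : 𝔤) :
    levelForm 𝔤 k (weightOperator (levelForm 𝔤 k) r x) x ≤ levelForm 𝔤 k x x := by
  have symm_sub : TensorProduct.comm ℝ 𝔤 𝔤 (s - r) = s - r := by rw [map_sub, hs.symm, hr.symm]
  set ψ := A.quad (-1) (s - r) (A.J x (-1) A.Ω) with hψ
  have annihilated (u) (hu : u ∈ U) (p : ℤ) (hp : 0 < p) : A.J u p ψ = 0 := by
    have lie_eq_zero : ⁅u, s - r⁆ = 0 := by
      rw [lie_sub, hs.lie_eq_zero u trivial, hr.lie_eq_zero u hu, sub_zero]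
    have weight_eq_zero : weightOperator (levelForm 𝔤 k) (s - r) u = 0 := by
      rw [map_sub, LinearMap.sub_apply, hs.weight_eq u trivial, hr.weight_eq u hu, sub_self]
    rw [hψ, A.J_apply_quad symm_sub, lie_eq_zero, weight_eq_zero, A.J_J_neg_one_vacuum u x hp]
    simp only [map_smul, A.quad_vacuum le_rfl, map_zero, LinearMap.zero_apply, Pi.zero_apply,
      smul_zero, add_zero]
  have quad_s : A.quad (-1) s (A.J x (-1) A.Ω) = A.J x (-2) A.Ω := by
    rw [A.quad_J_neg_one_vacuum hs.symm x le_rfl, hs.weight_eq x trivial, hs.lie_eq_zero x trivial,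
      map_zero, LinearMap.zero_apply, smul_zero, sub_zero]
    rfl
  have inner_self_eq : inner ℂ ψ ψ = ((2 * (levelForm 𝔤 k x x -
      levelForm 𝔤 k (weightOperator (levelForm 𝔤 k) r x) x) : ℝ) : ℂ) :=
    calc inner ℂ ψ ψ
        = inner ℂ ψ (A.quad (-1) s (A.J x (-1) A.Ω)) -
            inner ℂ ψ (A.quad (-1) r (A.J x (-1) A.Ω)) := by
          rw [← inner_sub_right, ← LinearMap.sub_apply, ← map_sub]
      _ = inner ℂ (A.J x 2 ψ) A.Ω := by
          rw [A.inner_quad_eq_zero annihilated hr.mem_map₂ (by lia), sub_zero, quad_s, A.hermitian]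
      _ = _ := by
          rw [A.J_two_quad_neg_one symm_sub, map_sub, LinearMap.sub_apply, hs.weight_eq x trivial,
            inner_smul_left, Complex.conj_ofReal, inner_self_eq_norm_sq_to_K, A.norm_vacuum,
            RCLike.ofReal_one, one_pow, mul_one, map_sub, LinearMap.sub_apply]
  have nonneg := inner_self_nonneg (𝕜 := ℂ) (x := ψ)
  rw [inner_self_eq, RCLike.re_eq_complex_re, Complex.ofReal_re] at nonneg
  linarith

end VacuumCurrents

end Vanishing

section Summands

variable {𝔤 𝔥 σ : Type*} [LieRing 𝔤] [LieAlgebra ℝ 𝔤] [LieRing 𝔥] [LieAlgebra ℝ 𝔥]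
  {ι : 𝔥 →ₗ⁅ℝ⁆ 𝔤} (D : ReductiveDecomposition 𝔥 σ)

variable (ι) in
/-- The map `embed` as a homomorphism of Lie algebras. -/
def embedHom (α : Option σ) : D.ideal α →ₗ⁅ℝ⁆ 𝔤 := ι.comp (D.ideal α).incl

theorem lie_embed_embed (α : Option σ) (x y : D.ideal α) :
    ⁅embed ι D α x, embed ι D α y⁆ = embed ι D α ⁅x, y⁆ :=
  ((embedHom ι D α).map_lie x y).symm

theorem embed_injective (hι : Function.Injective ι) (α : Option σ) :
    Function.Injective (embed ι D α) :=
  hι.comp Subtype.val_injective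

theorem lie_embed_of_ne {α β : Option σ} (hαβ : α ≠ β) (x : D.ideal α) (y : D.ideal β) :
    ⁅embed ι D α x, embed ι D β y⁆ = 0 := by
  have disjoint : Disjoint (D.ideal α) (D.ideal β) := D.independent.pairwiseDisjoint hαβ
  have mem_inf : ⁅(x : 𝔥), (y : 𝔥)⁆ ∈ D.ideal α ⊓ D.ideal β :=
    ⟨lie_mem_left ℝ 𝔥 (D.ideal α) x y x.2, lie_mem_right ℝ 𝔥 (D.ideal β) x y y.2⟩
  rw [disjoint.eq_bot, LieSubmodule.mem_bot] at mem_inf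
  exact (ι.map_lie x y).symm.trans (by rw [mem_inf, map_zero])

variable [FiniteDimensional ℝ 𝔤] [LieAlgebra.IsSimple ℝ 𝔤]

theorem normForm_embed_of_ne {α β : Option σ} (hαβ : α ≠ β) (x : D.ideal α) (y : D.ideal β) :
    normForm 𝔤 (embed ι D α x) (embed ι D β y) = 0 := by
  have simple_orthogonal (a : σ) {β : Option σ} (hβ : some a ≠ β) (x : D.ideal (some a))
      (y : D.ideal β) : normForm 𝔤 (embed ι D (some a) x) (embed ι D β y) = 0 := by
    have : LieAlgebra.IsSimple ℝ (D.ideal (some a)) := D.isSimple a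
    refine LinearMap.congr_fun (eq_zero_of_map_lie_eq_zero
      ((normForm 𝔤).flip (embed ι D β y) ∘ₗ embed ι D (some a)) fun z w => ?_) x
    change normForm 𝔤 (embed ι D (some a) ⁅z, w⁆) (embed ι D β y) = 0
    rw [← lie_embed_embed, lieInvariant_normForm, lie_embed_of_ne D hβ, map_zero, neg_zero]
  match α, β, hαβ, x, y with
  | some a, β, hne, x, y => exact simple_orthogonal a hne x y
  | none, some b, hne, x, y =>
    rw [(isSymm_normForm 𝔤).eq]
    exact simple_orthogonal b hne.symm y x

theorem lieInvariant_comp_embed (α : Option σ) :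
    ((normForm 𝔤).comp (embed ι D α) (embed ι D α)).lieInvariant (D.ideal α) := fun x y z => by
  simp only [LinearMap.BilinForm.comp_apply, ← lie_embed_embed, lieInvariant_normForm 𝔤 _ _]

variable [FiniteDimensional ℝ 𝔥]

theorem isMetric_metric (hm : IsMetric (normForm 𝔤)) (hι : Function.Injective ι) :
    ∀ α, IsMetric (metric ι D α)
  | none => hm.comp (embed_injective D hι none)
  | some a =>
    have : LieAlgebra.IsSimple ℝ (D.ideal (some a)) := D.isSimple a
    have hcomp := hm.comp (embed_injective D hι (some a))
    isMetric_normForm (𝔨 := D.ideal (some a)) fun _ hx =>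
      killingForm_neg_of_isMetric hcomp (lieInvariant_comp_embed D (some a)) hx

theorem lieInvariant_metric : ∀ α, (metric ι D α).lieInvariant (D.ideal α)
  | none => lieInvariant_comp_embed D none
  | some a =>
    have := D.isSimple a
    lieInvariant_normForm (D.simple a)

theorem normForm_comp_embed (hm : IsMetric (normForm 𝔤)) (hι : Function.Injective ι) :
    ∀ α, (normForm 𝔤).comp (embed ι D α) (embed ι D α) = dynkinIndex ι D α • metric ι D α
  | none => (one_smul ℝ _).symm
  | some a => by
    have : LieAlgebra.IsSimple ℝ (D.ideal (some a)) := D.isSimple a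
    obtain ⟨c, hc⟩ := exists_eq_smul_of_lieInvariant (isMetric_metric D hm hι (some a))
      (lieInvariant_metric D (some a)) (hm.comp (embed_injective D hι (some a))).isSymm
      (lieInvariant_comp_embed D (some a))
    have exists_index : ∃ I : ℝ, ∀ x y, normForm 𝔤 (embed ι D (some a) x)
        (embed ι D (some a) y) = I * metric ι D (some a) x y :=
      ⟨c, fun x y => LinearMap.congr_fun₂ hc x y⟩
    exact LinearMap.ext₂ (Classical.epsilon_spec exists_index)

theorem dynkinIndex_pos (hm : IsMetric (normForm 𝔤)) (hι : Function.Injective ι) :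
    ∀ α, 0 < dynkinIndex ι D α
  | none => one_pos
  | some a => by
    have : LieAlgebra.IsSimple ℝ (D.ideal (some a)) := D.isSimple a
    have := LieAlgebra.IsSimple.nontrivial ℝ (D.ideal (some a))
    obtain ⟨x, hx⟩ := exists_ne (0 : D.ideal (some a))
    have pos := (hm.comp (embed_injective D hι (some a))).pos x hx
    rw [normForm_comp_embed D hm hι] at pos
    exact pos_of_mul_pos_left pos ((isMetric_metric D hm hι (some a)).pos x hx).le

theorem coxeter_nonneg : ∀ α, 0 ≤ coxeter D α
  | none => le_rfl
  | some a =>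
    have := D.isSimple a
    (dualCoxeter_pos (D.simple a)).le

variable (ι) in
theorem killingForm_ideal : ∀ α, killingForm ℝ (D.ideal α) = (-(2 * coxeter D α)) • metric ι D α
  | none => by
    have : IsLieAbelian (D.ideal none) := D.isLieAbelian
    have coxeter_eq_zero : coxeter D none = 0 := rfl
    rw [coxeter_eq_zero, mul_zero, neg_zero, zero_smul]
    exact LieModule.traceForm_eq_zero_of_isTrivial ℝ (D.ideal none) (D.ideal none)
  | some a =>
    have := D.isSimple a
    killingForm_eq_smul_normForm (D.simple a)

end Summands

section StressTensors

variable {𝔤 𝔥 σ : Type*} [LieRing 𝔤] [LieAlgebra ℝ 𝔤] [FiniteDimensional ℝ 𝔤]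
  [LieAlgebra.IsSimple ℝ 𝔤] [LieRing 𝔥] [LieAlgebra ℝ 𝔥] [FiniteDimensional ℝ 𝔥]
  {ι : 𝔥 →ₗ⁅ℝ⁆ 𝔤} (D : ReductiveDecomposition 𝔥 σ) {k : ℕ}

theorem smul_proj (hm : IsMetric (normForm 𝔤)) (hι : Function.Injective ι)
    (α : Option σ) :
    dynkinIndex ι D α • proj ι D α = contract (metric ι D α) fun a b =>
      (normForm 𝔤 (embed ι D α b)).smulRight (embed ι D α a) := by
  have index_ne := (dynkinIndex_pos D hm hι α).ne'
  rw [proj, normForm_comp_embed D hm hι,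
    contract_smul_form (isMetric_metric D hm hι α).nondegenerate index_ne,
    smul_inv_smul₀ index_ne]

theorem weightOperator_map_embed_casimirTensor (hm : IsMetric (normForm 𝔤))
    (hι : Function.Injective ι) (α : Option σ) :
    weightOperator (levelForm 𝔤 k)
        (TensorProduct.map (embed ι D α) (embed ι D α) (casimirTensor (metric ι D α))) =
      (2 * dynkinIndex ι D α * k) • proj ι D α + casimir ι D α := by
  have contract_levelForm : contract (metric ι D α) (fun a b =>
      (levelForm 𝔤 k (embed ι D α b)).smulRight (embed ι D α a)) =
      (k : ℝ) • dynkinIndex ι D α • proj ι D α := by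
    rw [smul_proj D hm hι]
    exact contract_smul_smulRight (k : ℝ) (fun b => normForm 𝔤 (embed ι D α b)) (embed ι D α)
  have contract_ad : contract (metric ι D α) (fun a b =>
      LieAlgebra.ad ℝ 𝔤 (embed ι D α a) * LieAlgebra.ad ℝ 𝔤 (embed ι D α b)) =
      -casimir ι D α := by
    rw [casimir, contract_neg, neg_neg]
  rw [weightOperator_map_casimirTensor (isMetric_metric D hm hι α).isSymm, contract_levelForm,
    contract_ad, sub_neg_eq_add, smul_smul, smul_smul]
  congr 2
  ring

variable (𝔤 k) in
/-- The tensor of the stress-energy tensor `Θ^𝔤`. -/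
def tensorG : 𝔤 ⊗[ℝ] 𝔤 := sugawaraTensor LinearMap.id (normForm 𝔤) (k + dualCoxeter 𝔤)

variable (ι k) in
/-- The tensor of the stress-energy tensor `Θ^𝔥`. -/
def tensorH [Fintype σ] : 𝔤 ⊗[ℝ] 𝔤 :=
  ∑ α : Option σ,
    sugawaraTensor (embed ι D α) (metric ι D α) (dynkinIndex ι D α * k + coxeter D α)

theorem isSugawaraTensor_tensorG (hm : IsMetric (normForm 𝔤)) :
    IsSugawaraTensor (levelForm 𝔤 k) ⊤ (tensorG 𝔤 k) := by
  have level_add_ne : (k : ℝ) + dualCoxeter 𝔤 ≠ 0 :=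
    (add_pos_of_nonneg_of_pos k.cast_nonneg (dualCoxeter_pos 𝔤)).ne'
  have h := isSugawaraTensor_sugawaraTensor (B := levelForm 𝔤 k) hm.nondegenerate hm.isSymm
    (lieInvariant_normForm 𝔤) LieHom.id rfl (killingForm_eq_smul_normForm 𝔤) level_add_ne
  rwa [show ((LieHom.id : 𝔤 →ₗ⁅ℝ⁆ 𝔤) : 𝔤 →ₗ[ℝ] 𝔤) = LinearMap.id from rfl,
    LinearMap.range_id] at h

theorem isSugawaraTensor_embed (hm : IsMetric (normForm 𝔤)) (hι : Function.Injective ι)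
    (hk : 0 < k) (α : Option σ) :
    IsSugawaraTensor (levelForm 𝔤 k) (LinearMap.range (embed ι D α))
      (sugawaraTensor (embed ι D α) (metric ι D α) (dynkinIndex ι D α * k + coxeter D α)) := by
  have hmetric := isMetric_metric D hm hι α
  have level_pos : 0 < dynkinIndex ι D α * k :=
    mul_pos (dynkinIndex_pos D hm hι α) (Nat.cast_pos.mpr hk)
  have levelForm_comp : (levelForm 𝔤 k).comp (embed ι D α) (embed ι D α) =
      (dynkinIndex ι D α * k) • metric ι D α := by
    rw [mul_comm, mul_smul, ← normForm_comp_embed D hm hι]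
    rfl
  exact isSugawaraTensor_sugawaraTensor hmetric.nondegenerate hmetric.isSymm
    (lieInvariant_metric D α) (embedHom ι D α) levelForm_comp (killingForm_ideal ι D α)
    (add_pos_of_pos_of_nonneg level_pos (coxeter_nonneg D α)).ne'

variable [Fintype σ]

theorem isSugawaraTensor_tensorH (hm : IsMetric (normForm 𝔤)) (hι : Function.Injective ι)
    (hk : 0 < k) :
    IsSugawaraTensor (levelForm 𝔤 k) (⨆ α, LinearMap.range (embed ι D α)) (tensorH ι D k) := by
  refine IsSugawaraTensor.sum (isSugawaraTensor_embed D hm hι hk) ?_ ?_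
  · rintro α β hαβ _ ⟨x, rfl⟩ _ ⟨y, rfl⟩
    exact lie_embed_of_ne D hαβ x y
  · rintro α β hαβ _ ⟨x, rfl⟩ _ ⟨y, rfl⟩
    exact smul_eq_zero_of_right (k : ℝ) (normForm_embed_of_ne D hαβ x y)

theorem weightOperator_tensorH (hm : IsMetric (normForm 𝔤)) (hι : Function.Injective ι) :
    weightOperator (levelForm 𝔤 k) (tensorH ι D k) = weightedCasimir ι D k := by
  simp only [tensorH, sugawaraTensor, weightedCasimir, map_sum, map_smul,
    weightOperator_map_embed_casimirTensor D hm hι]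

variable {V : Type*} [NormedAddCommGroup V] [InnerProductSpace ℂ V] (A : VacuumCurrents 𝔤 k V)

theorem sugawara_eq_quad {E : Type*} [AddCommGroup E] [Module ℝ E] [FiniteDimensional ℝ E]
    (τ : E →ₗ[ℝ] 𝔤) (S : LinearMap.BilinForm ℝ E) (N : ℝ) (n : ℤ) (φ : V) :
    sugawara A τ S N n φ = A.quad n (sugawaraTensor τ S N) φ := by
  rw [sugawaraTensor, map_smul, LinearMap.smul_apply, VacuumCurrents.quadCut_apply, sugawara]
  congr! 4 with m
  refine Eq.trans ?_ (map_casimirTensor (A.quadTerm 0 n m ∘ₗ TensorProduct.map τ τ)).symm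
  congr! 3
  exact (A.quadTerm_tmul 0 n m (τ _) (τ _)).symm

theorem stressH_eq_stressG_iff :
    stressH A ι D = stressG A ↔ ∀ n, A.quad n (tensorH ι D k) = A.quad n (tensorG 𝔤 k) := by
  simp only [funext_iff, LinearMap.ext_iff, stressH, stressG, tensorH, tensorG, Finset.sum_apply,
    sugawara_eq_quad, map_sum, LinearMap.sum_apply]

end StressTensors

end CurrentAlgebra

end

theorem mainTheorem1 {𝔤 𝔥 σ V : Type*}
    [LieRing 𝔤] [LieAlgebra ℝ 𝔤] [FiniteDimensional ℝ 𝔤] [LieAlgebra.IsSimple ℝ 𝔤]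
    (hcompact : ∀ x : 𝔤, x ≠ 0 → killingForm ℝ 𝔤 x x < 0)
    [LieRing 𝔥] [LieAlgebra ℝ 𝔥] [FiniteDimensional ℝ 𝔥]
    [Fintype σ] (D : ReductiveDecomposition 𝔥 σ)
    (ι : 𝔥 →ₗ⁅ℝ⁆ 𝔤) (hι : Function.Injective ι)
    (k : ℕ) (hk : 0 < k)
    [NormedAddCommGroup V] [InnerProductSpace ℂ V] (A : VacuumCurrents 𝔤 k V) :
    (∀ x y : 𝔤, normForm 𝔤 (weightedCasimir ι D k x) y =
      normForm 𝔤 x (weightedCasimir ι D k y)) ∧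
    (∀ x : 𝔤, normForm 𝔤 x (weightedCasimir ι D k x) ≤ normForm 𝔤 x x) ∧
    (weightedCasimir ι D k = 1 ↔ stressH A ι D = stressG A) := by
  have hm : IsMetric (normForm 𝔤) := isMetric_normForm hcompact
  have level_pos : (0 : ℝ) < k := Nat.cast_pos.mpr hk
  have sugawaraH := isSugawaraTensor_tensorH D hm hι hk
  have sugawaraG := isSugawaraTensor_tensorG (k := k) hm
  have weightG : weightOperator (levelForm 𝔤 k) (tensorG 𝔤 k) = 1 :=
    LinearMap.ext fun x => sugawaraG.weight_eq x trivial
  have weightH := weightOperator_tensorH D (k := k) hm hι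
  refine ⟨fun x y => mul_left_cancel₀ level_pos.ne' ?_,
    fun x => le_of_mul_le_mul_left ?_ level_pos, ?_⟩
  · have symm := form_weightOperator_left (isSymm_levelForm (k := k)) lieInvariant_levelForm
      (tensorH ι D k) x y
    rwa [sugawaraH.symm, weightH] at symm
  · have le := A.form_weightOperator_le sugawaraG sugawaraH x
    rwa [weightH, isSymm_levelForm.eq] at le
  · rw [stressH_eq_stressG_iff,
      A.forall_quad_eq_iff (hm.smul level_pos) sugawaraH.symm sugawaraG.symm, weightH, weightG]
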